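/- Let $(\Omega,\mathcal F,P)$ be a probability space, let $d\ge 1$ be an integer, and let $\mathcal G$ be a real vector space of random variables on $\Omega$, each of which is Gaussian (not necessarily centred, possibly degenerate). Let $\overline{\Pi}^d_{\mathcal G}(\mathbb R)$ be the closure, with respect to convergence in probability, of the set of random variables $q(Z_1,\dots,Z_n)$ with $n\ge 1$, $Z_1,\dots,Z_n\in\mathcal G$ and $q:\mathbb R^n\to\mathbb R$ a polynomial of degree at most $d$. Let $F$ be a locally convex Hausdorff real topological vector space with dual $F^*$, and assume that $F$ is metrizable or strongly Lindelöf (every open cover of every subset of $F$ has a countable subcover). Let $X:\Omega\to F$ be a Borel measurable random element that is a.s. separably valued, i.e. $P(X\in A)=1$ for some separable closed set $A\subseteq F$, and suppose that $x^*(X)\in\overline{\Pi}^d_{\mathcal G}(\mathbb R)$ for all $x^*\in F^*$. Let $N:F\to[0,\infty]$ be a lower semicontinuous pseudo-seminorm, i.e. $N(\lambda x)=|\lambda|N(x)$ (with $0\cdot\infty=0$) and $N(x+y)\le N(x)+N(y)$ for all $x,y\in F$, $\lambda\in\mathbb R$, and suppose that $N(X)<\infty$ a.s. Write $\|N(X)\|_p=E[N(X)^p]^{1/p}$.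 Then for all real $1<p<r$, $$\|N(X)\|_r\le 2^{d^2/2+d}\left(\frac{r-1}{p-1}\right)^{d/2}\|N(X)\|_p<\infty,$$ and $$E\big[e^{\varepsilon N(X)^{2/d}}\big]<\infty\qquad\text{for all real }\varepsilon<\frac{d}{e\,2^{d+5}\,\|N(X)\|_2^{2/d}},$$ where the right-hand side is read as $+\infty$ if $\|N(X)\|_2=0$. -/

import Mathlib

open MeasureTheory ProbabilityTheory Filter TopologicalSpace
open scoped ENNReal Topology

namespace GaussianChaos

/-- A pseudo-seminorm on a real vector space: a map into `[0, ∞]` that is absolutely homogeneous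
(with the convention `0 * ∞ = 0`, so that `N 0 = 0`) and subadditive. -/
structure IsPseudoSeminorm {F : Type*} [AddCommGroup F] [Module ℝ F] (N : F → ℝ≥0∞) : Prop where
  smul : ∀ (c : ℝ) (x : F), N (c • x) = ENNReal.ofReal |c| * N x
  add_le : ∀ x y : F, N (x + y) ≤ N x + N y

/-- `X` is a.s. separably valued: it lies a.s. in some closed subset that is separable in its
subspace topology. -/
def AESeparablyValued {Ω F : Type*} [MeasurableSpace Ω] [TopologicalSpace F]
    (P : Measure Ω) (X : Ω → F) : Prop :=
  ∃ A : Set F, IsClosed A ∧ SeparableSpace A ∧ ∀ᵐ ω ∂P, X ω ∈ A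

/-- `𝒢`, a real vector space of functions on `Ω`, consists of Gaussian random variables
(not necessarily centred; constants are degenerate Gaussian variables). -/
def IsGaussianSpace {Ω : Type*} [MeasurableSpace Ω] (P : Measure Ω)
    (𝒢 : Submodule ℝ (Ω → ℝ)) : Prop :=
  ∀ Z ∈ 𝒢, HasGaussianLaw Z P

/-- The random variables `q(Z₁, …, Zₙ)` with `Z₁, …, Zₙ ∈ 𝒢` and `q` a real polynomial of total
degree at most `d` (not necessarily tetrahedral). -/
def gaussianPolynomials {Ω : Type*} (𝒢 : Submodule ℝ (Ω → ℝ)) (d : ℕ) : Set (Ω → ℝ) :=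
  {Y | ∃ (n : ℕ) (Z : Fin n → Ω → ℝ) (q : MvPolynomial (Fin n) ℝ),
    (∀ i, Z i ∈ 𝒢) ∧ q.totalDegree ≤ d ∧ Y = fun ω => MvPolynomial.eval (fun i => Z i ω) q}

/-- The closure in probability of the Gaussian polynomials of degree at most `d`. Convergence in
probability is metrizable, so limits of sequences suffice. -/
def gaussianChaos {Ω : Type*} [MeasurableSpace Ω] (P : Measure Ω)
    (𝒢 : Submodule ℝ (Ω → ℝ)) (d : ℕ) : Set (Ω → ℝ) :=
  {Y | ∃ Q : ℕ → Ω → ℝ, (∀ k, Q k ∈ gaussianPolynomials 𝒢 d) ∧ TendstoInMeasure P Q atTop Y}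

end GaussianChaos

namespace GaussianChaos

/-! The argument has three independent ingredients.

Hypercontractivity. For standard Gaussian vectors `w`, `z` and `ρ ^ 2 ≤ (p - 1) / (r - 1)`,
averaging `M (ρ w + √(1 - ρ²) z)` over `z` maps `L^p` to `L^r` with norm one. Its dual form is a
two-function inequality for `F ^ a * G ^ b`. On a Gaussian step of size `σ`, a second-order
expansion makes the first-order terms vanish in mean, the second-order terms form a quadratic form
that is nonpositive exactly because `a b ρ² ≤ (1 - a)(1 - b)`, and the error is `O(σ³)`. Composing
`n` steps of variance `1 / n` costs a factor `(1 + C n ^ (-3/2)) ^ n`, which tends to `1`.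
Approximation, Fubini and duality do the rest (`twoFunctionIneq_pi_gaussianReal`,
`gaussian_hypercontractive`).

Extrapolation. For a polynomial `Q` of degree at most `d`, the average of `Q (t x + √(1 - t²) z)`
over `z` is a polynomial in `t` of degree at most `d`, with value `Q x` at `t = 1`. Lagrange
interpolation at nodes in `[0, ρ]` recovers `Q x` from averages to which hypercontractivity applies.
The coefficients do not depend on `Q`, so the same bound holds for a supremum of polynomials
(`eLpNorm_iSup_eval_le`); their absolute sum is the constant of the theorem.

Passage to the limit. Moment comparison survives almost sure convergence to a finite limit: a
Paley–Zygmund argument bounds the second moments, hence all moments, and uniform integrability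
follows (`MomentComparison.of_tendsto_ae`). By Hahn–Banach and the Lindelöf property, `N` is on the
essential range of `X` a countable supremum of `|φ n|` with `φ n` continuous and linear. So `N (X)`
is reached from Gaussian polynomials through finite suprema of limits in probability, then an
increasing limit.

Exponential integrability follows by expanding the exponential and comparing the terms with a
geometric series. -/

/-! ### Elementary second-order bounds for concave powers -/

/-- Bernoulli's inequality for the concave power `1 - a` at `-(x / (1 + x))`, combined with `x - x²
≤ x / (1 + x)`. This controls the derivative of `(1 + x) ^ a` to the right of `0`. -/
lemma rpow_sub_one_le {a x : ℝ} (ha : 0 < a) (ha1 : a < 1) (hx : 0 ≤ x) :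
    (1 + x) ^ (a - 1) ≤ 1 - (1 - a) * x + (1 - a) * x ^ 2 := by
  have h1 : 0 < 1 + x := by linarith
  have h2 : (1 + x) ^ (a - 1) = (1 + (-(x / (1 + x)))) ^ (1 - a) := by
    rw [show 1 + -(x / (1 + x)) = (1 + x)⁻¹ by field_simp; ring,
      Real.inv_rpow h1.le, ← Real.rpow_neg h1.le]
    congr 1; ring
  have h3 : x / (1 + x) ≤ 1 := by rw [div_le_one h1]; linarith
  have h4 := rpow_one_add_le_one_add_mul_self (s := -(x / (1 + x))) (by linarith)
    (p := 1 - a) (by linarith) (by linarith)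
  have h5 : x - x ^ 2 ≤ x / (1 + x) := by
    rw [le_div_iff₀ h1]; nlinarith [pow_nonneg hx 3]
  rw [h2]
  nlinarith

/-- Take reciprocals in Bernoulli's inequality for the power `1 - a` and use `(1 - u) (1 + u) ≤ 1`.
This controls the derivative of `(1 + s) ^ a` to the left of `0`. -/
lemma le_rpow_sub_one {a s : ℝ} (ha : 0 < a) (ha1 : a < 1) (hs : -1 < s) :
    1 - (1 - a) * s ≤ (1 + s) ^ (a - 1) := by
  have h1 : 0 < 1 + s := by linarith
  have h4 := rpow_one_add_le_one_add_mul_self (s := s) (by linarith)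
    (p := 1 - a) (by linarith) (by linarith)
  have h5 : 0 < (1 + s) ^ (1 - a) := Real.rpow_pos_of_pos h1 _
  rw [show a - 1 = -(1 - a) by ring, Real.rpow_neg h1.le, ← one_div, le_div_iff₀ h5]
  by_cases h : 0 ≤ 1 - (1 - a) * s
  · calc _ ≤ (1 - (1 - a) * s) * (1 + (1 - a) * s) := by gcongr
      _ ≤ 1 := by nlinarith [sq_nonneg ((1 - a) * s)]
  · nlinarith

/-- Second-order Taylor upper bound for `(1 + s) ^ a` with cubic error, uniform on `[-1, ∞)`. -/
lemma one_add_rpow_le_taylor {a s : ℝ} (ha : 0 < a) (ha1 : a < 1) (hs : -1 ≤ s) :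
    (1 + s) ^ a ≤ 1 + a * s - a * (1 - a) / 2 * s ^ 2 + |s| ^ 3 := by
  have hder : ∀ x : ℝ, -1 < x → HasDerivAt (fun x : ℝ => (1 + x) ^ a) (a * (1 + x) ^ (a - 1)) x := by
    intro x hx
    have := ((hasDerivAt_id x).const_add 1).rpow_const (p := a) (Or.inl (by simp; linarith))
    simpa using this
  have hcont : Continuous (fun x : ℝ => (1 + x) ^ a) :=
    (continuous_const.add continuous_id).rpow_const (fun _ => Or.inr ha.le)
  rcases le_total 0 s with h | h
  · let F : ℝ → ℝ := fun x => 1 + a * x - a * (1 - a) / 2 * x ^ 2 + x ^ 3 - (1 + x) ^ a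
    have hF : ∀ x : ℝ, -1 < x →
        HasDerivAt F (a - a * (1 - a) * x + 3 * x ^ 2 - a * (1 + x) ^ (a - 1)) x := by
      intro x hx
      have h0 := ((((hasDerivAt_id x).const_mul a).const_add 1).sub
        (((hasDerivAt_id x).pow 2).const_mul (a * (1 - a) / 2))).add ((hasDerivAt_id x).pow 3)
      refine (h0.sub (hder x hx)).congr_deriv ?_
      simp; ring
    have hmono : MonotoneOn F (Set.Ici 0) := by
      refine monotoneOn_of_deriv_nonneg (convex_Ici 0) ?_ ?_ ?_
      · exact (by fun_prop : Continuous fun x : ℝ =>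
          1 + a * x - a * (1 - a) / 2 * x ^ 2 + x ^ 3).sub hcont |>.continuousOn
      · intro x hx
        rw [interior_Ici] at hx
        exact (hF x (by linarith [hx.out])).differentiableAt.differentiableWithinAt
      · intro x hx
        rw [interior_Ici] at hx
        have hx0 : 0 < x := hx
        rw [(hF x (by linarith)).deriv]
        have := rpow_sub_one_le ha ha1 hx0.le
        have h1 := mul_le_mul_of_nonneg_left this ha.le
        have h2 : a * (1 - a) * x ^ 2 ≤ 1 * x ^ 2 := by
          gcongr
          exact mul_le_one₀ ha1.le (by linarith) (by linarith)
        nlinarith [sq_nonneg x]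
    have := hmono (Set.mem_Ici.2 le_rfl) (Set.mem_Ici.2 h) h
    simp only [F] at this
    rw [abs_of_nonneg h]
    norm_num at this
    linarith
  -- To the left of `0` the Taylor remainder has the favourable sign (the third derivative is
  -- positive), so no cubic term is needed.
  · let F : ℝ → ℝ := fun x => 1 + a * x - a * (1 - a) / 2 * x ^ 2 - (1 + x) ^ a
    have hF : ∀ x : ℝ, -1 < x →
        HasDerivAt F (a - a * (1 - a) * x - a * (1 + x) ^ (a - 1)) x := by
      intro x hx
      have h0 := (((hasDerivAt_id x).const_mul a).const_add 1).sub
        (((hasDerivAt_id x).pow 2).const_mul (a * (1 - a) / 2))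
      refine (h0.sub (hder x hx)).congr_deriv ?_
      simp; ring
    have hmono : AntitoneOn F (Set.Icc (-1) 0) := by
      refine antitoneOn_of_deriv_nonpos (convex_Icc _ _) ?_ ?_ ?_
      · exact (by fun_prop : Continuous fun x : ℝ =>
          1 + a * x - a * (1 - a) / 2 * x ^ 2).sub hcont |>.continuousOn
      · intro x hx
        rw [interior_Icc] at hx
        exact (hF x hx.1).differentiableAt.differentiableWithinAt
      · intro x hx
        rw [interior_Icc] at hx
        rw [(hF x hx.1).deriv]
        have := le_rpow_sub_one ha ha1 hx.1
        nlinarith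
    have := hmono (Set.mem_Icc.2 ⟨hs, h⟩) (Set.mem_Icc.2 ⟨by norm_num, le_rfl⟩) h
    simp only [F] at this
    norm_num at this
    have : 0 ≤ |s| ^ 3 := by positivity
    linarith

lemma mul_one_sub_div_two_mem {a : ℝ} (ha : 0 < a) (ha1 : a < 1) :
    0 ≤ a * (1 - a) / 2 ∧ a * (1 - a) / 2 ≤ 1 := by
  constructor <;> nlinarith

lemma mul_le_of_le_of_mem_unit {c x E : ℝ} (hc : 0 ≤ c ∧ c ≤ 1) (hx : x ≤ E) (hE : 0 ≤ E) :
    c * x ≤ E :=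
  (mul_le_mul_of_nonneg_left hx hc.1).trans (mul_le_of_le_one_left hE hc.2)

/-- Multiply the two one-variable expansions. All products beyond second order, and the cubic
remainders, are bounded by powers of `w` from `3` to `6`, which `4 w³ (1 + w)³` dominates
coefficientwise. -/
lemma rpow_mul_rpow_le_taylor {a b s t w : ℝ} (ha : 0 < a) (ha1 : a < 1) (hb : 0 < b)
    (hb1 : b < 1) (hs : -1 ≤ s) (ht : -1 ≤ t) (hsw : |s| ≤ w) (htw : |t| ≤ w) :
    (1 + s) ^ a * (1 + t) ^ b ≤ 1 + a * s + b * t +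
      (-(a * (1 - a) / 2) * s ^ 2 - b * (1 - b) / 2 * t ^ 2 + a * b * (s * t)) +
      4 * w ^ 3 * (1 + w) ^ 3 := by
  have hw : 0 ≤ w := (abs_nonneg s).trans hsw
  have hA := one_add_rpow_le_taylor ha ha1 hs
  have hB := one_add_rpow_le_taylor hb hb1 ht
  have hs0 : 0 ≤ (1 + s) ^ a := Real.rpow_nonneg (by linarith) _
  have ht0 : 0 ≤ (1 + t) ^ b := Real.rpow_nonneg (by linarith) _
  have hs3 : |s| ^ 3 ≤ w ^ 3 := by gcongr
  have ht3 : |t| ^ 3 ≤ w ^ 3 := by gcongr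
  have hs2 : s ^ 2 ≤ w ^ 2 := by rw [← sq_abs s]; gcongr
  have ht2 : t ^ 2 ≤ w ^ 2 := by rw [← sq_abs t]; gcongr
  set P := -(a * (1 - a) / 2 * s ^ 2) + |s| ^ 3 with hP
  set Q := -(b * (1 - b) / 2 * t ^ 2) + |t| ^ 3 with hQ
  have hca := mul_one_sub_div_two_mem ha ha1
  have hcb := mul_one_sub_div_two_mem hb hb1
  have hPa : |P| ≤ w ^ 2 + w ^ 3 := by
    have h1 : 0 ≤ a * (1 - a) / 2 * s ^ 2 := by have := hca.1; positivity
    have h2 : a * (1 - a) / 2 * s ^ 2 ≤ w ^ 2 := by nlinarith [sq_nonneg s]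
    have h3 : 0 ≤ |s| ^ 3 := by positivity
    have h4 : 0 ≤ w ^ 2 := by positivity
    rw [abs_le]; constructor <;> linarith
  have hQa : |Q| ≤ w ^ 2 + w ^ 3 := by
    have h1 : 0 ≤ b * (1 - b) / 2 * t ^ 2 := by have := hcb.1; positivity
    have h2 : b * (1 - b) / 2 * t ^ 2 ≤ w ^ 2 := by nlinarith [sq_nonneg t]
    have h3 : 0 ≤ |t| ^ 3 := by positivity
    have h4 : 0 ≤ w ^ 2 := by positivity
    rw [abs_le]; constructor <;> linarith
  have has : |a * s| ≤ w := by rw [abs_mul, abs_of_pos ha]; nlinarith [abs_nonneg s]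
  have hbt : |b * t| ≤ w := by rw [abs_mul, abs_of_pos hb]; nlinarith [abs_nonneg t]
  have h1 : a * s * Q ≤ w * (w ^ 2 + w ^ 3) := by
    refine (le_abs_self _).trans ?_; rw [abs_mul]; gcongr
  have h2 : b * t * P ≤ w * (w ^ 2 + w ^ 3) := by
    refine (le_abs_self _).trans ?_; rw [abs_mul]; gcongr
  have h3 : P * Q ≤ (w ^ 2 + w ^ 3) * (w ^ 2 + w ^ 3) := by
    refine (le_abs_self _).trans ?_; rw [abs_mul]; gcongr
  have hprod : (1 + s) ^ a * (1 + t) ^ b ≤ (1 + a * s + P) * (1 + b * t + Q) := by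
    refine mul_le_mul (by rw [hP]; linarith) (by rw [hQ]; linarith) ht0 ?_
    rw [hP]; linarith
  have hw3 : 0 ≤ w ^ 3 := by positivity
  have hw4 : 0 ≤ w ^ 4 := by positivity
  have hw5 : 0 ≤ w ^ 5 := by positivity
  have hw6 : 0 ≤ w ^ 6 := by positivity
  have e1 : 4 * w ^ 3 * (1 + w) ^ 3 = 4 * w ^ 3 + 12 * w ^ 4 + 12 * w ^ 5 + 4 * w ^ 6 := by ring
  rw [e1]
  have e2 : (1 + a * s + P) * (1 + b * t + Q) = 1 + a * s + b * t + a * b * (s * t) + P + Q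
    + a * s * Q + b * t * P + P * Q := by ring
  have e3 : w * (w ^ 2 + w ^ 3) = w ^ 3 + w ^ 4 := by ring
  have e4 : (w ^ 2 + w ^ 3) * (w ^ 2 + w ^ 3) = w ^ 4 + 2 * w ^ 5 + w ^ 6 := by ring
  rw [e3] at h1 h2
  rw [e4] at h3
  rw [e2] at hprod
  refine hprod.trans ?_
  rw [show P = -(a * (1 - a) / 2) * s ^ 2 + |s| ^ 3 by rw [hP]; ring] at *
  rw [show Q = -(b * (1 - b) / 2) * t ^ 2 + |t| ^ 3 by rw [hQ]; ring] at *
  linarith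

/-- The bound of `rpow_mul_rpow_le_taylor` when `s` and `t` are close to linear. -/
lemma rpow_mul_rpow_le_of_almost_linear {a b s t x y α β K σ W : ℝ} (ha : 0 < a) (ha1 : a < 1)
    (hb : 0 < b) (hb1 : b < 1) (hs : -1 ≤ s) (ht : -1 ≤ t) (hσ : 0 ≤ σ) (hσ1 : σ ≤ 1)
    (hK : 1 ≤ K) (hW : 1 ≤ W) (hsw : |s| ≤ K * σ * W) (htw : |t| ≤ K * σ * W)
    (hx : |x| ≤ W) (hy : |y| ≤ W) (hα : |α| ≤ K) (hβ : |β| ≤ K)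
    (hsx : |s - σ * (α * x)| ≤ K * σ ^ 2 * W ^ 2) (hty : |t - σ * (β * y)| ≤ K * σ ^ 2 * W ^ 2) :
    (1 + s) ^ a * (1 + t) ^ b ≤ 1 + a * s + b * t + σ ^ 2 *
      (-(a * (1 - a) / 2) * (α ^ 2 * x ^ 2) - b * (1 - b) / 2 * (β ^ 2 * y ^ 2)
        + a * b * (α * β) * (x * y)) + 40 * K ^ 6 * σ ^ 3 * W ^ 6 := by
  have h0 := rpow_mul_rpow_le_taylor ha ha1 hb hb1 hs ht hsw htw
  have hxa : |σ * (α * x)| ≤ K * σ * W := by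
    rw [abs_mul, abs_mul, abs_of_nonneg hσ]
    calc σ * (|α| * |x|) ≤ σ * (K * W) := by gcongr
      _ = _ := by ring
  have hya : |σ * (β * y)| ≤ K * σ * W := by
    rw [abs_mul, abs_mul, abs_of_nonneg hσ]
    calc σ * (|β| * |y|) ≤ σ * (K * W) := by gcongr
      _ = _ := by ring
  have key : ∀ {p q p' q' : ℝ}, |p| ≤ K * σ * W → |q| ≤ K * σ * W → |p'| ≤ K * σ * W →
      |q'| ≤ K * σ * W → |p - p'| ≤ K * σ ^ 2 * W ^ 2 → |q - q'| ≤ K * σ ^ 2 * W ^ 2 →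
      |p * q - p' * q'| ≤ 2 * K ^ 2 * σ ^ 3 * W ^ 3 := by
    intro p q p' q' h1 h2 h3 h4 h5 h6
    rw [show p * q - p' * q' = (p - p') * q + p' * (q - q') by ring]
    refine (abs_add_le _ _).trans ?_
    rw [abs_mul, abs_mul]
    calc _ ≤ (K * σ ^ 2 * W ^ 2) * (K * σ * W) + (K * σ * W) * (K * σ ^ 2 * W ^ 2) := by gcongr
      _ = _ := by ring
  have k1 := abs_le.1 (key hsw hsw hxa hxa hsx hsx)
  have k2 := abs_le.1 (key htw htw hya hya hty hty)
  have k3 := abs_le.1 (key hsw htw hxa hya hsx hty)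
  have hca := mul_one_sub_div_two_mem ha ha1
  have hcb := mul_one_sub_div_two_mem hb hb1
  have hab : 0 ≤ a * b ∧ a * b ≤ 1 := ⟨by positivity, mul_le_one₀ ha1.le hb.le hb1.le⟩
  set E := 2 * K ^ 2 * σ ^ 3 * W ^ 3 with hE
  have hE0 : 0 ≤ E := by positivity
  have m1 : a * (1 - a) / 2 * ((σ * (α * x)) * (σ * (α * x)) - s * s) ≤ E :=
    mul_le_of_le_of_mem_unit hca (by linarith [k1.1]) hE0
  have m2 : b * (1 - b) / 2 * ((σ * (β * y)) * (σ * (β * y)) - t * t) ≤ E :=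
    mul_le_of_le_of_mem_unit hcb (by linarith [k2.1]) hE0
  have m3 : a * b * (s * t - (σ * (α * x)) * (σ * (β * y))) ≤ E :=
    mul_le_of_le_of_mem_unit hab k3.2 hE0
  have hKp : K ^ 2 ≤ K ^ 6 := pow_le_pow_right₀ hK (by norm_num)
  have hWp : W ^ 3 ≤ W ^ 6 := pow_le_pow_right₀ hW (by norm_num)
  have hEb : E ≤ 2 * K ^ 6 * σ ^ 3 * W ^ 6 := by rw [hE]; gcongr
  -- The cubic error contributes `32`, and replacing each of the three quadratic terms by its
  -- linearisation contributes at most `2`; the total `38` is rounded up to `40`.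
  have hcub : 4 * (K * σ * W) ^ 3 * (1 + K * σ * W) ^ 3 ≤ 32 * K ^ 6 * σ ^ 3 * W ^ 6 := by
    have hKW : 1 ≤ K * W := one_le_mul_of_one_le_of_one_le hK hW
    have h1 : 1 + K * σ * W ≤ 2 * (K * W) := by
      have : K * σ * W ≤ K * 1 * W := by gcongr
      linarith
    calc _ ≤ 4 * (K * σ * W) ^ 3 * (2 * (K * W)) ^ 3 := by gcongr
      _ = _ := by ring
  have h1 : 0 ≤ K ^ 6 * σ ^ 3 * W ^ 6 := by positivity
  have h2 : -(a * (1 - a) / 2) * s ^ 2 - b * (1 - b) / 2 * t ^ 2 + a * b * (s * t) ≤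
      σ ^ 2 * (-(a * (1 - a) / 2) * (α ^ 2 * x ^ 2) - b * (1 - b) / 2 * (β ^ 2 * y ^ 2)
        + a * b * (α * β) * (x * y)) + 3 * E := by
    linear_combination m1 + m2 + m3
  linarith

/-! ### Regular functions and a single small Gaussian step -/

/-- Functions bounded below by `m` and above by `M` that are Lipschitz and differentiable with a
uniform second-order Taylor estimate. -/
structure TaylorBounded (m M L : ℝ) (f : ℝ → ℝ) : Prop where
  continuous : Continuous f
  lower : ∀ x, m ≤ f x
  upper : ∀ x, f x ≤ M
  deriv_le : ∀ x, |deriv f x| ≤ L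
  lipschitz : ∀ x h, |f (x + h) - f x| ≤ L * |h|
  taylor : ∀ x h, |f (x + h) - f x - deriv f x * h| ≤ L * h ^ 2

lemma integrable_pow_gaussianReal (v : NNReal) (n : ℕ) :
    Integrable (fun x : ℝ => x ^ n) (gaussianReal 0 v) := by
  have h : MemLp (fun x : ℝ => x) n (gaussianReal 0 v) :=
    memLp_id_gaussianReal' n (ENNReal.natCast_ne_top n)
  refine h.integrable_norm_pow'.mono' (by fun_prop) (ae_of_all _ fun x => ?_)
  simp

lemma integral_sq_gaussianReal (v : NNReal) : ∫ x, x ^ 2 ∂(gaussianReal 0 v) = v := by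
  have h := variance_fun_id_gaussianReal (μ := 0) (v := v)
  rwa [variance_of_integral_eq_zero (by fun_prop) (by simp)] at h

/-- A sum of independent centred Gaussians is Gaussian and the variances add up to `(ρ² + ρ'²) v =
v`. -/
lemma measurePreserving_rotate {ρ ρ' : ℝ} (h : ρ ^ 2 + ρ' ^ 2 = 1) (v : NNReal) :
    MeasurePreserving (fun w : ℝ × ℝ => ρ * w.1 + ρ' * w.2)
      ((gaussianReal 0 v).prod (gaussianReal 0 v)) (gaussianReal 0 v) := by
  refine ⟨by fun_prop, ?_⟩
  have h1 : ((gaussianReal 0 v).map (ρ * ·)).prod ((gaussianReal 0 v).map (ρ' * ·)) =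
      ((gaussianReal 0 v).prod (gaussianReal 0 v)).map (Prod.map (ρ * ·) (ρ' * ·)) :=
    Measure.map_prod_map _ _ (by fun_prop) (by fun_prop)
  have h2 : ((gaussianReal 0 v).prod (gaussianReal 0 v)).map
      (fun w : ℝ × ℝ => ρ * w.1 + ρ' * w.2) =
      ((gaussianReal 0 v).map (ρ * ·)) ∗ ((gaussianReal 0 v).map (ρ' * ·)) := by
    rw [Measure.conv, h1, Measure.map_map (by fun_prop) (by fun_prop)]
    rfl
  rw [h2, gaussianReal_map_const_mul, gaussianReal_map_const_mul, gaussianReal_conv_gaussianReal]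
  congr 1
  · simp
  · ext; push_cast; rw [← add_mul]
    simp [h]

namespace TaylorBounded

variable {m M L : ℝ} {f : ℝ → ℝ}

lemma norm_le (hf : TaylorBounded m M L f) (hm : 0 < m) (x : ℝ) : ‖f x‖ ≤ M := by
  rw [Real.norm_of_nonneg (hm.le.trans (hf.lower x))]; exact hf.upper x

lemma integrable_comp (hf : TaylorBounded m M L f) (hm : 0 < m) {α : Type*} [MeasurableSpace α]
    (μ : Measure α) [IsFiniteMeasure μ] {φ : α → ℝ} (hφ : Measurable φ) :
    Integrable (fun x => f (φ x)) μ :=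
  Integrable.of_bound (hf.continuous.measurable.comp hφ).aestronglyMeasurable M
    (ae_of_all _ fun _ => hf.norm_le hm _)

/-- Fluctuations of `f` under a Gaussian step of size `σ`, normalised by the mean. -/
lemma exists_fluctuation (hf : TaylorBounded m M L f) (hm : 0 < m) {K σ : ℝ} (hK : L / m ≤ K)
    (hσ : 0 ≤ σ) (hσ1 : σ ≤ 1) (p : ℝ) :
    ∃ (s : ℝ → ℝ) (α : ℝ), Continuous s ∧ (∀ x, -1 ≤ s x) ∧
      Integrable s (gaussianReal 0 1) ∧ ∫ x, s x ∂(gaussianReal 0 1) = 0 ∧ |α| ≤ K ∧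
      (∀ x, |s x| ≤ K * σ * (1 + |x|)) ∧ (∀ x, |s x - σ * (α * x)| ≤ K * σ ^ 2 * (1 + x ^ 2)) ∧
      0 < ∫ x, f (p + σ * x) ∂(gaussianReal 0 1) ∧
      ∀ x, f (p + σ * x) = (∫ x, f (p + σ * x) ∂(gaussianReal 0 1)) * (1 + s x) := by
  set u := ∫ x, f (p + σ * x) ∂(gaussianReal 0 1) with hu
  have hL : 0 ≤ L := (abs_nonneg _).trans (hf.deriv_le 0)
  have hint : Integrable (fun x => f (p + σ * x)) (gaussianReal 0 1) :=
    hf.integrable_comp hm _ (by fun_prop)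
  have hmu : m ≤ u := by
    have := integral_mono (integrable_const m) hint (fun x => hf.lower (p + σ * x))
    simpa using this
  have hu0 : 0 < u := hm.trans_le hmu
  have hKu : ∀ c, 0 ≤ c → L * c / u ≤ K * c := fun c hc => by
    rw [mul_comm L, mul_div_assoc, mul_comm]
    gcongr
    exact (div_le_div_of_nonneg_left hL hm hmu).trans hK
  have hI1 : Integrable (fun x : ℝ => x) (gaussianReal 0 1) := by
    simpa using integrable_pow_gaussianReal 1 1
  -- The first-order term has mean zero, so the value at the centre differs from the mean only at
  -- second order.
  have hup : |f p - u| ≤ L * σ ^ 2 := by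
    have e : f p - u = - ∫ x, (f (p + σ * x) - f p - deriv f p * (σ * x)) ∂(gaussianReal 0 1) := by
      have e1 := integral_sub (hint.sub (integrable_const (f p)))
        ((hI1.const_mul σ).const_mul (deriv f p))
      have e2 := integral_sub hint (integrable_const (f p))
      simp only [Pi.sub_apply, integral_const_mul] at e1 e2
      rw [e1, e2, ← hu, integral_const_mul]
      simp
    rw [e, abs_neg]
    refine (abs_integral_le_integral_abs).trans ?_
    calc _ ≤ ∫ x, L * σ ^ 2 * x ^ 2 ∂(gaussianReal 0 1) := by
          refine integral_mono ?_ ((integrable_pow_gaussianReal 1 2).const_mul _) ?_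
          · exact ((hint.sub (integrable_const _)).sub ((hI1.const_mul _).const_mul _)).abs
          · intro x
            refine (hf.taylor p (σ * x)).trans_eq (by ring)
      _ = L * σ ^ 2 := by rw [integral_const_mul, integral_sq_gaussianReal]; simp
  -- Relative fluctuation around the mean, with its linear coefficient. Dividing by `u ≥ m` turns
  -- `L` into `L / m ≤ K`.
  refine ⟨fun x => (f (p + σ * x) - u) / u, deriv f p / u, ?_, ?_, ?_, ?_, ?_, ?_, ?_, hu0, ?_⟩
  · have := hf.continuous
    fun_prop
  · intro x
    rw [le_div_iff₀ hu0]
    linarith [hf.lower (p + σ * x)]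
  · exact (hint.sub (integrable_const _)).div_const _
  · rw [integral_div, integral_sub hint (integrable_const _)]
    simp [← hu]
  · rw [abs_div, abs_of_pos hu0]
    calc _ ≤ L * 1 / u := by gcongr; simpa using hf.deriv_le p
      _ ≤ K * 1 := hKu 1 zero_le_one
      _ = K := mul_one K
  · intro x
    rw [abs_div, abs_of_pos hu0]
    have h1 : |f (p + σ * x) - u| ≤ L * (σ * (1 + |x|)) := by
      calc _ = |(f (p + σ * x) - f p) + (f p - u)| := by congr 1; ring
        _ ≤ L * |σ * x| + L * σ ^ 2 := (abs_add_le _ _).trans (add_le_add (hf.lipschitz _ _) hup)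
        _ ≤ L * (σ * |x|) + L * σ := by
          rw [abs_mul, abs_of_nonneg hσ]; gcongr; nlinarith
        _ = _ := by ring
    calc _ ≤ L * (σ * (1 + |x|)) / u := by gcongr
      _ ≤ K * (σ * (1 + |x|)) := hKu _ (by positivity)
      _ = _ := by ring
  · intro x
    have h1 : |f (p + σ * x) - u - deriv f p * (σ * x)| ≤ L * (σ ^ 2 * (1 + x ^ 2)) := by
      calc _ = |(f (p + σ * x) - f p - deriv f p * (σ * x)) + (f p - u)| := by congr 1; ring
        _ ≤ L * (σ * x) ^ 2 + L * σ ^ 2 := (abs_add_le _ _).trans (add_le_add (hf.taylor _ _) hup)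
        _ = _ := by ring
    calc _ = |f (p + σ * x) - u - deriv f p * (σ * x)| / u := by
          rw [← abs_of_pos hu0, ← abs_div, abs_of_pos hu0]; congr 1; field_simp
      _ ≤ L * (σ ^ 2 * (1 + x ^ 2)) / u := by gcongr
      _ ≤ K * (σ ^ 2 * (1 + x ^ 2)) := hKu _ (by positivity)
      _ = _ := by ring
  · intro x
    field_simp
    ring

end TaylorBounded

/-- Complete the square: after multiplication by `a (1 - a)`, what remains is a multiple of `β²`
whose coefficient is nonnegative by the hypothesis on `ρ`. This is the only place where that
hypothesis acts. -/
lemma quadratic_form_nonpos {a b ρ : ℝ} (ha : 0 < a) (ha1 : a < 1) (hb : 0 < b) (hb1 : b < 1)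
    (hρ : a * b * ρ ^ 2 ≤ (1 - a) * (1 - b)) (α β : ℝ) :
    -(a * (1 - a) / 2) * α ^ 2 + -(b * (1 - b) / 2) * β ^ 2 + a * b * (α * β) * ρ ≤ 0 := by
  have h1 : 0 < 1 - a := by linarith
  have h2 : 0 < 1 - b := by linarith
  have h3 : 0 ≤ a * (1 - a) * (a * (1 - a) * α ^ 2 + b * (1 - b) * β ^ 2
      - 2 * (a * b * ρ) * (α * β)) := by
    have e : a * (1 - a) * (a * (1 - a) * α ^ 2 + b * (1 - b) * β ^ 2
      - 2 * (a * b * ρ) * (α * β)) = (a * (1 - a) * α - a * b * ρ * β) ^ 2 +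
        a * b * ((1 - a) * (1 - b) - a * b * ρ ^ 2) * β ^ 2 := by ring
    rw [e]
    have : 0 ≤ (1 - a) * (1 - b) - a * b * ρ ^ 2 := by linarith
    positivity
  have h4 := nonneg_of_mul_nonneg_right h3 (by positivity)
  linarith

lemma integrable_one_add_abs_pow :
    Integrable (fun w : ℝ × ℝ => (1 + |w.1| + |w.2|) ^ 6)
      ((gaussianReal 0 1).prod (gaussianReal 0 1)) := by
  have h1 : MemLp (fun w : ℝ × ℝ => w.1) 6 ((gaussianReal 0 1).prod (gaussianReal 0 1)) :=
    (memLp_id_gaussianReal' 6 (by simp)).comp_measurePreserving measurePreserving_fst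
  have h2 : MemLp (fun w : ℝ × ℝ => w.2) 6 ((gaussianReal 0 1).prod (gaussianReal 0 1)) :=
    (memLp_id_gaussianReal' 6 (by simp)).comp_measurePreserving measurePreserving_snd
  have h3 := (((memLp_const (1 : ℝ)).add h1.norm).add h2.norm).integrable_norm_pow (by norm_num)
  refine h3.congr (ae_of_all _ fun w => ?_)
  simp only [Pi.add_apply, Real.norm_eq_abs]
  rw [abs_of_nonneg (by positivity)]

/-- One Gaussian step of size `σ`: the two-function inequality up to an error `O(σ³)`. -/
lemma exists_step_bound {a b ρ ρ' m M L : ℝ} (ha : 0 < a) (ha1 : a < 1) (hb : 0 < b)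
    (hb1 : b < 1) (hρρ' : ρ ^ 2 + ρ' ^ 2 = 1) (hρ : a * b * ρ ^ 2 ≤ (1 - a) * (1 - b))
    (hm : 0 < m) :
    ∃ C : ℝ, 0 ≤ C ∧ ∀ f g : ℝ → ℝ, TaylorBounded m M L f → TaylorBounded m M L g →
      ∀ σ p q : ℝ, 0 ≤ σ → σ ≤ 1 →
      ∫ w : ℝ × ℝ, f (p + σ * w.1) ^ a * g (q + σ * (ρ * w.1 + ρ' * w.2)) ^ b
          ∂((gaussianReal 0 1).prod (gaussianReal 0 1)) ≤
        (∫ x, f (p + σ * x) ∂(gaussianReal 0 1)) ^ a *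
          (∫ x, g (q + σ * x) ∂(gaussianReal 0 1)) ^ b * (1 + C * σ ^ 3) := by
  set Γ := (gaussianReal 0 1).prod (gaussianReal 0 1) with hΓ
  set K := max 1 (L / m) with hKdef
  have hK : 1 ≤ K := le_max_left _ _
  have hK0 : 0 ≤ K := zero_le_one.trans hK
  set I := ∫ w : ℝ × ℝ, (1 + |w.1| + |w.2|) ^ 6 ∂Γ with hI
  have hI0 : 0 ≤ I := integral_nonneg fun w => by positivity
  refine ⟨40 * K ^ 6 * I, by positivity, fun f g hf hg σ p q hσ hσ1 => ?_⟩
  obtain ⟨s, α, hsc, hs1, hsi, hs0, hα, hsK, hsα, hu, hfs⟩ :=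
    hf.exists_fluctuation hm (K := K) (le_max_right _ _) hσ hσ1 p
  obtain ⟨t, β, htc, ht1, hti, ht0, hβ, htK, htβ, hv, hgt⟩ :=
    hg.exists_fluctuation hm (K := K) (le_max_right _ _) hσ hσ1 q
  set u := ∫ x, f (p + σ * x) ∂(gaussianReal 0 1)
  set v := ∫ x, g (q + σ * x) ∂(gaussianReal 0 1)
  have hmp := measurePreserving_rotate hρρ' 1
  have hmp1 : MeasurePreserving (Prod.fst : ℝ × ℝ → ℝ) Γ (gaussianReal 0 1) :=
    measurePreserving_fst
  have hmp2 : MeasurePreserving (Prod.snd : ℝ × ℝ → ℝ) Γ (gaussianReal 0 1) :=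
    measurePreserving_snd
  have hρ1 : |ρ| ≤ 1 := by rw [← sq_le_one_iff_abs_le_one]; nlinarith [sq_nonneg ρ']
  have hρ1' : |ρ'| ≤ 1 := by rw [← sq_le_one_iff_abs_le_one]; nlinarith [sq_nonneg ρ]
  have hy : ∀ w : ℝ × ℝ, |ρ * w.1 + ρ' * w.2| ≤ |w.1| + |w.2| := fun w => by
    refine (abs_add_le _ _).trans ?_
    rw [abs_mul, abs_mul]
    exact add_le_add (mul_le_of_le_one_left (abs_nonneg _) hρ1)
      (mul_le_of_le_one_left (abs_nonneg _) hρ1')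
  let R : ℝ × ℝ → ℝ := fun w => 1 + a * s w.1 + b * t (ρ * w.1 + ρ' * w.2) + σ ^ 2 *
      (-(a * (1 - a) / 2) * (α ^ 2 * w.1 ^ 2) - b * (1 - b) / 2 * (β ^ 2 * (ρ * w.1 + ρ' * w.2) ^ 2)
        + a * b * (α * β) * (w.1 * (ρ * w.1 + ρ' * w.2)))
      + 40 * K ^ 6 * σ ^ 3 * (1 + |w.1| + |w.2|) ^ 6
  have hpt : ∀ w : ℝ × ℝ, (1 + s w.1) ^ a * (1 + t (ρ * w.1 + ρ' * w.2)) ^ b ≤ R w := by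
    intro w
    have hW : (1 : ℝ) ≤ 1 + |w.1| + |w.2| := by linarith [abs_nonneg w.1, abs_nonneg w.2]
    have hW2 : ∀ x : ℝ, |x| ≤ |w.1| + |w.2| → 1 + x ^ 2 ≤ (1 + |w.1| + |w.2|) ^ 2 := by
      intro x hx
      nlinarith [sq_abs x, abs_nonneg x]
    have hx1 : |w.1| ≤ |w.1| + |w.2| := by linarith [abs_nonneg w.2]
    refine rpow_mul_rpow_le_of_almost_linear ha ha1 hb hb1 (hs1 _) (ht1 _) hσ hσ1 hK hW
      ((hsK _).trans ?_) ((htK _).trans ?_) (by linarith) (by linarith [hy w]) hα hβ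
      ((hsα _).trans ?_) ((htβ _).trans ?_)
    · exact mul_le_mul_of_nonneg_left (by linarith) (by positivity)
    · exact mul_le_mul_of_nonneg_left (by linarith [hy w]) (by positivity)
    · gcongr; exact hW2 _ hx1
    · gcongr; exact hW2 _ (hy w)
  have i1 : Integrable (fun w : ℝ × ℝ => s w.1) Γ := hmp1.integrable_comp_of_integrable hsi
  have i2 : Integrable (fun w : ℝ × ℝ => t (ρ * w.1 + ρ' * w.2)) Γ :=
    hmp.integrable_comp_of_integrable hti
  have i3 : Integrable (fun w : ℝ × ℝ => w.1 ^ 2) Γ :=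
    hmp1.integrable_comp_of_integrable (integrable_pow_gaussianReal 1 2)
  have i4 : Integrable (fun w : ℝ × ℝ => (ρ * w.1 + ρ' * w.2) ^ 2) Γ :=
    hmp.integrable_comp_of_integrable (integrable_pow_gaussianReal 1 2)
  have j1 : Integrable (fun x : ℝ => x) (gaussianReal 0 1) := by
    simpa using integrable_pow_gaussianReal 1 1
  have i5 : Integrable (fun w : ℝ × ℝ => w.1 * w.2) Γ := j1.mul_prod j1
  have i6 : Integrable (fun w : ℝ × ℝ => w.1 * (ρ * w.1 + ρ' * w.2)) Γ :=
    ((i3.const_mul ρ).add (i5.const_mul ρ')).congr (ae_of_all _ fun w => by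
      simp only [Pi.add_apply]; ring)
  have i7 := integrable_one_add_abs_pow
  have e1 : ∫ w : ℝ × ℝ, s w.1 ∂Γ = 0 := by
    rw [← hs0, ← hmp1.map_eq, integral_map (by fun_prop) (by fun_prop)]
  have e2 : ∫ w : ℝ × ℝ, t (ρ * w.1 + ρ' * w.2) ∂Γ = 0 := by
    rw [← ht0, ← hmp.map_eq, integral_map (by fun_prop) (by fun_prop)]
  have e3 : ∫ w : ℝ × ℝ, w.1 ^ 2 ∂Γ = 1 := by
    have := integral_sq_gaussianReal 1
    rw [← hmp1.map_eq, integral_map (by fun_prop) (by fun_prop)] at this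
    simpa using this
  have e4 : ∫ w : ℝ × ℝ, (ρ * w.1 + ρ' * w.2) ^ 2 ∂Γ = 1 := by
    have := integral_sq_gaussianReal 1
    rw [← hmp.map_eq, integral_map (by fun_prop) (by fun_prop)] at this
    simpa using this
  have e5 : ∫ w : ℝ × ℝ, w.1 * w.2 ∂Γ = 0 := by
    rw [hΓ, integral_prod_mul (fun x => x) (fun x => x)]; simp
  have e6 : ∫ w : ℝ × ℝ, w.1 * (ρ * w.1 + ρ' * w.2) ∂Γ = ρ := by
    have : ∀ w : ℝ × ℝ, w.1 * (ρ * w.1 + ρ' * w.2) = ρ * w.1 ^ 2 + ρ' * (w.1 * w.2) :=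
      fun w => by ring
    simp_rw [this]
    rw [integral_add (i3.const_mul ρ) (i5.const_mul ρ'), integral_const_mul, integral_const_mul,
      e3, e5]
    ring
  have k1 := (((integrable_const (1 : ℝ)).add (i1.const_mul a)).add (i2.const_mul b))
  have k2 := (((i3.const_mul (α ^ 2)).const_mul (-(a * (1 - a) / 2))).sub
    ((i4.const_mul (β ^ 2)).const_mul (b * (1 - b) / 2)))
  have k3 := i6.const_mul (a * b * (α * β))
  have hRi : Integrable R Γ :=
    (k1.add ((k2.add k3).const_mul (σ ^ 2))).add (i7.const_mul (40 * K ^ 6 * σ ^ 3))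
  have hR : ∫ w, R w ∂Γ = 1 + σ ^ 2 * (-(a * (1 - a) / 2) * α ^ 2 + -(b * (1 - b) / 2) * β ^ 2
      + a * b * (α * β) * ρ) + 40 * K ^ 6 * σ ^ 3 * I := by
    have s1 : ∫ w, R w ∂Γ = _ := integral_add (k1.add ((k2.add k3).const_mul (σ ^ 2)))
      (i7.const_mul (40 * K ^ 6 * σ ^ 3))
    have s2 := integral_add k1 ((k2.add k3).const_mul (σ ^ 2))
    have s3 := integral_add ((integrable_const (1 : ℝ)).add (i1.const_mul a)) (i2.const_mul b)
    have s4 := integral_add (integrable_const (μ := Γ) (1 : ℝ)) (i1.const_mul a)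
    have s5 := integral_add k2 k3
    have s6 := integral_sub ((i3.const_mul (α ^ 2)).const_mul (-(a * (1 - a) / 2)))
      ((i4.const_mul (β ^ 2)).const_mul (b * (1 - b) / 2))
    simp only [Pi.add_apply, Pi.sub_apply, integral_const_mul] at s1 s2 s3 s4 s5 s6
    rw [s1, s2, s3, s4, s5, s6, e1, e2, e3, e4, e6, ← hI]
    simp only [integral_const, probReal_univ, smul_eq_mul]
    ring
  -- The terms linear in `s` and `t` integrate to zero, and the `σ²` term is a nonpositive quadratic
  -- form in `(α, β)`; only the cubic error is left.
  have hle : ∫ w : ℝ × ℝ, (1 + s w.1) ^ a * (1 + t (ρ * w.1 + ρ' * w.2)) ^ b ∂Γ ≤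
      1 + 40 * K ^ 6 * I * σ ^ 3 := by
    calc _ ≤ ∫ w, R w ∂Γ := by
          refine integral_mono_of_nonneg (ae_of_all _ fun w => ?_) hRi (ae_of_all _ hpt)
          exact mul_nonneg (Real.rpow_nonneg (by linarith [hs1 w.1]) _)
            (Real.rpow_nonneg (by linarith [ht1 (ρ * w.1 + ρ' * w.2)]) _)
      _ ≤ _ := by
        rw [hR]
        nlinarith [mul_nonneg (sq_nonneg σ) (neg_nonneg.2 (quadratic_form_nonpos ha ha1 hb hb1 hρ α β))]
  calc _ = u ^ a * v ^ b *
        ∫ w : ℝ × ℝ, (1 + s w.1) ^ a * (1 + t (ρ * w.1 + ρ' * w.2)) ^ b ∂Γ := by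
        rw [← integral_const_mul]
        refine integral_congr_ae (ae_of_all _ fun w => ?_)
        simp only
        rw [hfs, hgt, Real.mul_rpow hu.le (by linarith [hs1 w.1]),
          Real.mul_rpow hv.le (by linarith [ht1 (ρ * w.1 + ρ' * w.2)])]
        ring
    _ ≤ _ := by gcongr

lemma hasDerivAt_of_taylor_bound {f : ℝ → ℝ} {x D L : ℝ}
    (h : ∀ t, |f (x + t) - f x - D * t| ≤ L * t ^ 2) : HasDerivAt f D x := by
  rw [hasDerivAt_iff_isLittleO_nhds_zero]
  have h1 : (fun t : ℝ => f (x + t) - f x - t • D) =O[𝓝 0] fun t => t ^ 2 := by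
    refine Asymptotics.IsBigO.of_bound L (Eventually.of_forall fun t => ?_)
    rw [Real.norm_eq_abs, Real.norm_of_nonneg (sq_nonneg t), smul_eq_mul, mul_comm t]
    exact h t
  exact h1.trans_isLittleO (Asymptotics.isLittleO_pow_id (by norm_num))

namespace TaylorBounded

variable {m M L : ℝ} {f g : ℝ → ℝ}

/-- The class is stable under averaging of translates. -/
lemma average (hf : TaylorBounded m M L f) (hm : 0 < m) (μ : Measure ℝ) [IsProbabilityMeasure μ] :
    TaylorBounded m M L (fun x => ∫ z, f (x + z) ∂μ) := by
  have hint : ∀ x, Integrable (fun z => f (x + z)) μ :=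
    fun x => hf.integrable_comp hm _ (by fun_prop)
  have hintd : ∀ x, Integrable (fun z => deriv f (x + z)) μ := fun x =>
    Integrable.of_bound ((measurable_deriv f).comp (measurable_const_add x)).aestronglyMeasurable
      L (ae_of_all _ fun z => hf.deriv_le _)
  have hbd : ∀ (φ : ℝ → ℝ) (c : ℝ), (∀ z, |φ z| ≤ c) → |∫ z, φ z ∂μ| ≤ c := by
    intro φ c hφ
    have := norm_integral_le_of_norm_le_const (μ := μ)
      (ae_of_all _ fun z => (Real.norm_eq_abs _).trans_le (hφ z))
    simpa using this
  have hlip : ∀ x h, |(∫ z, f (x + h + z) ∂μ) - ∫ z, f (x + z) ∂μ| ≤ L * |h| := by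
    intro x h
    rw [← integral_sub (hint _) (hint _)]
    refine hbd _ _ fun z => ?_
    rw [show x + h + z = x + z + h by ring]
    exact hf.lipschitz _ _
  have htay : ∀ x h, |(∫ z, f (x + h + z) ∂μ) - (∫ z, f (x + z) ∂μ)
      - (∫ z, deriv f (x + z) ∂μ) * h| ≤ L * h ^ 2 := by
    intro x h
    have e := integral_sub ((hint (x + h)).sub (hint x)) ((hintd x).mul_const h)
    simp only [Pi.sub_apply] at e
    rw [← integral_sub (hint _) (hint _), ← integral_mul_const, ← e]
    refine hbd _ _ fun z => ?_
    rw [show x + h + z = x + z + h by ring]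
    exact hf.taylor _ _
  have hder : ∀ x, deriv (fun x => ∫ z, f (x + z) ∂μ) x = ∫ z, deriv f (x + z) ∂μ := fun x =>
    (hasDerivAt_of_taylor_bound (f := fun x => ∫ z, f (x + z) ∂μ) (htay x)).deriv
  refine ⟨?_, fun x => ?_, fun x => ?_, fun x => ?_, hlip, fun x h => ?_⟩
  · refine (LipschitzWith.of_dist_le' (K := L) fun x y => ?_).continuous
    have := hlip y (x - y)
    simpa [Real.dist_eq] using this
  · have := integral_mono (integrable_const m) (hint x) (fun z => hf.lower (x + z))
    simpa using this
  · have := integral_mono (hint x) (integrable_const M) (fun z => hf.upper (x + z))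
    simpa using this
  · rw [hder]; exact hbd _ _ fun z => hf.deriv_le _
  · simp only [hder]; exact htay x h

lemma measurable_kernel (hf : TaylorBounded m M L f) (hg : TaylorBounded m M L g) (a b : ℝ)
    {α : Type*} [MeasurableSpace α] {φ ψ : α → ℝ} (hφ : Measurable φ) (hψ : Measurable ψ) :
    Measurable (fun w => ENNReal.ofReal (f (φ w) ^ a * g (ψ w) ^ b)) :=
  (((hf.continuous.measurable.comp hφ).pow_const a).mul
    ((hg.continuous.measurable.comp hψ).pow_const b)).ennreal_ofReal

end TaylorBounded

/-! ### Composition of small steps and the two-function inequality for regular functions -/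

lemma gaussianReal_zero_eq_map (v : NNReal) :
    gaussianReal 0 v = (gaussianReal 0 1).map (√(v : ℝ) * ·) := by
  rw [gaussianReal_map_const_mul]
  congr 1
  · simp
  · ext; simp

/-- The one-step bound rescaled to variance `v`, so `σ = √v`, and written with iterated lower
integrals, where Fubini needs only measurability. The constant `C` is chosen before `f` and `g`,
which the induction over steps relies on. -/
lemma exists_step_bound_lintegral {a b ρ ρ' m M L : ℝ} (ha : 0 < a) (ha1 : a < 1) (hb : 0 < b)
    (hb1 : b < 1) (hρρ' : ρ ^ 2 + ρ' ^ 2 = 1) (hρ : a * b * ρ ^ 2 ≤ (1 - a) * (1 - b))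
    (hm : 0 < m) :
    ∃ C : ℝ, 0 ≤ C ∧ ∀ f g : ℝ → ℝ, TaylorBounded m M L f → TaylorBounded m M L g →
      ∀ (v : NNReal) (p q : ℝ), v ≤ 1 →
      ∫⁻ w, ∫⁻ z, ENNReal.ofReal (f (p + w) ^ a * g (q + (ρ * w + ρ' * z)) ^ b)
          ∂(gaussianReal 0 v) ∂(gaussianReal 0 v) ≤
        ENNReal.ofReal (1 + C * √(v : ℝ) ^ 3) *
        ENNReal.ofReal ((∫ x, f (p + x) ∂(gaussianReal 0 v)) ^ a *
          (∫ x, g (q + x) ∂(gaussianReal 0 v)) ^ b) := by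
  obtain ⟨C, hC, h⟩ := exists_step_bound (M := M) (L := L) ha ha1 hb hb1 hρρ' hρ hm
  refine ⟨C, hC, fun f g hf hg v p q hv => ?_⟩
  have h1 := h f g hf hg (√(v : ℝ)) p q (Real.sqrt_nonneg _) (Real.sqrt_le_one.2 (by exact_mod_cast hv))
  set σ := √(v : ℝ)
  have hmeas : Measurable fun x : ℝ => σ * x := by fun_prop
  have ef : ∀ F : ℝ → ℝ, TaylorBounded m M L F → ∀ p, ∫ x, F (p + x) ∂(gaussianReal 0 v) =
      ∫ x, F (p + σ * x) ∂(gaussianReal 0 1) := fun F hF p => by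
    rw [gaussianReal_zero_eq_map, integral_map hmeas.aemeasurable]
    exact (hF.continuous.comp (by fun_prop)).aestronglyMeasurable
  rw [ef f hf, ef g hg, ← ENNReal.ofReal_mul (by positivity), mul_comm (1 + C * σ ^ 3)]
  refine le_trans (le_of_eq ?_) (ENNReal.ofReal_le_ofReal h1)
  have hnn : ∀ x y, 0 ≤ f x ^ a * g y ^ b := fun x y =>
    mul_nonneg (Real.rpow_nonneg (hm.le.trans (hf.lower x)) _)
      (Real.rpow_nonneg (hm.le.trans (hg.lower y)) _)
  have hK : Measurable fun w : ℝ × ℝ =>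
      ENNReal.ofReal (f (p + w.1) ^ a * g (q + (ρ * w.1 + ρ' * w.2)) ^ b) :=
    hf.measurable_kernel hg a b (by fun_prop) (by fun_prop)
  rw [ofReal_integral_eq_lintegral_ofReal, lintegral_prod, gaussianReal_zero_eq_map,
    lintegral_map hK.lintegral_prod_right' hmeas]
  · refine lintegral_congr fun w => ?_
    refine (lintegral_map (hK.comp (by fun_prop : Measurable fun z : ℝ => (σ * w, z))) hmeas).trans
      (lintegral_congr fun z => ?_)
    simp only [Function.comp]
    congr 4
    ring
  · exact (hf.measurable_kernel hg a b (by fun_prop) (by fun_prop)).aemeasurable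
  · refine Integrable.of_bound ?_ (M ^ a * M ^ b) (ae_of_all _ fun w => ?_)
    · exact (((hf.continuous.measurable.comp (by fun_prop)).pow_const a).mul
        ((hg.continuous.measurable.comp (by fun_prop)).pow_const b)).aestronglyMeasurable
    · rw [Real.norm_of_nonneg (hnn _ _)]
      have := hm.le.trans (hf.lower (p + σ * w.1))
      have := hm.le.trans (hg.lower (q + σ * (ρ * w.1 + ρ' * w.2)))
      gcongr
      · exact Real.rpow_nonneg (hm.le.trans ((hf.lower 0).trans (hf.upper 0))) _
      · exact hf.upper _
      · exact hg.upper _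
  · exact ae_of_all _ fun w => hnn _ _

/-- `k` Gaussian steps of variance `v`. -/
lemma exists_iterated_bound {a b ρ ρ' m M L : ℝ} (ha : 0 < a) (ha1 : a < 1) (hb : 0 < b)
    (hb1 : b < 1) (hρρ' : ρ ^ 2 + ρ' ^ 2 = 1) (hρ : a * b * ρ ^ 2 ≤ (1 - a) * (1 - b))
    (hm : 0 < m) :
    ∃ C : ℝ, 0 ≤ C ∧ ∀ (v : NNReal), v ≤ 1 → ∀ (k : ℕ) (f g : ℝ → ℝ), TaylorBounded m M L f →
      TaylorBounded m M L g → ∀ (p q : ℝ),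
      ∫⁻ w, ∫⁻ z, ENNReal.ofReal (f (p + w) ^ a * g (q + (ρ * w + ρ' * z)) ^ b)
          ∂(gaussianReal 0 (k * v)) ∂(gaussianReal 0 (k * v)) ≤
        ENNReal.ofReal (1 + C * √(v : ℝ) ^ 3) ^ k *
        ENNReal.ofReal ((∫ x, f (p + x) ∂(gaussianReal 0 (k * v))) ^ a *
          (∫ x, g (q + x) ∂(gaussianReal 0 (k * v))) ^ b) := by
  obtain ⟨C, hC, h⟩ := exists_step_bound_lintegral (M := M) (L := L) ha ha1 hb hb1 hρρ' hρ hm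
  refine ⟨C, hC, fun v hv k => ?_⟩
  induction k with
  | zero => intro f g hf hg p q; simp
  | succ k ih =>
    intro f g hf hg p q
    have hconv : gaussianReal 0 ((k + 1 : ℕ) * v) =
        (gaussianReal 0 (k * v)) ∗ (gaussianReal 0 v) := by
      rw [gaussianReal_conv_gaussianReal, add_zero]; congr 1; push_cast; ring
    set D := ENNReal.ofReal (1 + C * √(v : ℝ) ^ 3)
    have hK : Measurable fun w : ℝ × ℝ =>
        ENNReal.ofReal (f (p + w.1) ^ a * g (q + (ρ * w.1 + ρ' * w.2)) ^ b) :=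
      hf.measurable_kernel hg a b (by fun_prop) (by fun_prop)
    have ef : ∀ F : ℝ → ℝ, TaylorBounded m M L F → ∀ p,
        ∫ x, F (p + x) ∂(gaussianReal 0 ((k + 1 : ℕ) * v)) =
        ∫ x, (∫ z, F (p + x + z) ∂(gaussianReal 0 v)) ∂(gaussianReal 0 (k * v)) := fun F hF p => by
      rw [hconv, integral_conv (hF.integrable_comp hm _ (by fun_prop))]
      simp only [add_assoc]
    rw [ef f hf, ef g hg, pow_succ, mul_assoc]
    -- The averaged functions stay in the class with the same `m`, `M`, `L`, so the induction
    -- hypothesis applies to them with the same `C`.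
    have hf' := hf.average hm (gaussianReal 0 v)
    have hg' := hg.average hm (gaussianReal 0 v)
    calc _ = ∫⁻ w, ∫⁻ w', ∫⁻ z, ∫⁻ z', ENNReal.ofReal (f (p + (w + w')) ^ a *
            g (q + (ρ * (w + w') + ρ' * (z + z'))) ^ b) ∂(gaussianReal 0 v)
            ∂(gaussianReal 0 (k * v)) ∂(gaussianReal 0 v) ∂(gaussianReal 0 (k * v)) := by
          rw [hconv, Measure.lintegral_conv hK.lintegral_prod_right']
          refine lintegral_congr fun w => lintegral_congr fun w' => ?_
          exact Measure.lintegral_conv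
            (hK.comp (by fun_prop : Measurable fun z : ℝ => (w + w', z)))
      _ = ∫⁻ w, ∫⁻ z, ∫⁻ w', ∫⁻ z', ENNReal.ofReal (f (p + w + w') ^ a *
            g ((q + (ρ * w + ρ' * z)) + (ρ * w' + ρ' * z')) ^ b) ∂(gaussianReal 0 v)
            ∂(gaussianReal 0 v) ∂(gaussianReal 0 (k * v)) ∂(gaussianReal 0 (k * v)) := by
          -- Swapping the integrals in `w'` and `z` puts the last step of variance `v` innermost,
          -- where the one-step bound applies at the shifted base points.
          refine lintegral_congr fun w => ?_
          rw [lintegral_lintegral_swap]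
          · refine lintegral_congr fun z => lintegral_congr fun w' => lintegral_congr fun z' => ?_
            congr 3 <;> congr 1 <;> ring
          · have : Measurable fun y : (ℝ × ℝ) × ℝ => ENNReal.ofReal (f (p + (w + y.1.1)) ^ a *
                g (q + (ρ * (w + y.1.1) + ρ' * (y.1.2 + y.2))) ^ b) :=
              hf.measurable_kernel hg a b (by fun_prop) (by fun_prop)
            exact this.lintegral_prod_right'.aemeasurable
      _ ≤ ∫⁻ w, ∫⁻ z, D * ENNReal.ofReal ((∫ x, f (p + w + x) ∂(gaussianReal 0 v)) ^ a *
            (∫ x, g ((q + (ρ * w + ρ' * z)) + x) ∂(gaussianReal 0 v)) ^ b)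
            ∂(gaussianReal 0 (k * v)) ∂(gaussianReal 0 (k * v)) := by
          gcongr with w z
          exact h f g hf hg v _ _ hv
      _ = D * ∫⁻ w, ∫⁻ z, ENNReal.ofReal ((∫ x, f (p + w + x) ∂(gaussianReal 0 v)) ^ a *
            (∫ x, g ((q + (ρ * w + ρ' * z)) + x) ∂(gaussianReal 0 v)) ^ b)
            ∂(gaussianReal 0 (k * v)) ∂(gaussianReal 0 (k * v)) := by
          have hK' : Measurable fun w : ℝ × ℝ =>
              ENNReal.ofReal ((∫ x, f (p + w.1 + x) ∂(gaussianReal 0 v)) ^ a *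
                (∫ x, g ((q + (ρ * w.1 + ρ' * w.2)) + x) ∂(gaussianReal 0 v)) ^ b) :=
            hf'.measurable_kernel hg' a b (φ := fun w : ℝ × ℝ => p + w.1)
              (ψ := fun w : ℝ × ℝ => q + (ρ * w.1 + ρ' * w.2)) (by fun_prop) (by fun_prop)
          rw [← lintegral_const_mul _ hK'.lintegral_prod_right']
          refine lintegral_congr fun w => ?_
          exact lintegral_const_mul _ (hK'.comp (by fun_prop : Measurable fun z : ℝ => (w, z)))
      _ ≤ D * (D ^ k * _) := by
          gcongr
          exact ih _ _ hf' hg' p q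
      _ = _ := by ring

/-- Two-function Gaussian hypercontractivity for regular functions. -/
lemma TaylorBounded.lintegral_mul_le {a b ρ ρ' m M L : ℝ} {f g : ℝ → ℝ} (ha : 0 < a) (ha1 : a < 1)
    (hb : 0 < b) (hb1 : b < 1) (hρρ' : ρ ^ 2 + ρ' ^ 2 = 1)
    (hρ : a * b * ρ ^ 2 ≤ (1 - a) * (1 - b)) (hm : 0 < m)
    (hf : TaylorBounded m M L f) (hg : TaylorBounded m M L g) :
    ∫⁻ w, ∫⁻ z, ENNReal.ofReal (f w ^ a * g (ρ * w + ρ' * z) ^ b)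
          ∂(gaussianReal 0 1) ∂(gaussianReal 0 1) ≤
        ENNReal.ofReal ((∫ x, f x ∂(gaussianReal 0 1)) ^ a *
          (∫ x, g x ∂(gaussianReal 0 1)) ^ b) := by
  obtain ⟨C, hC, h⟩ := exists_iterated_bound (M := M) (L := L) ha ha1 hb hb1 hρρ' hρ hm
  set A := ∫⁻ w, ∫⁻ z, ENNReal.ofReal (f w ^ a * g (ρ * w + ρ' * z) ^ b)
          ∂(gaussianReal 0 1) ∂(gaussianReal 0 1)
  set B := ENNReal.ofReal ((∫ x, f x ∂(gaussianReal 0 1)) ^ a *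
          (∫ x, g x ∂(gaussianReal 0 1)) ^ b)
  have hn : ∀ n : ℕ, A ≤ ENNReal.ofReal (Real.exp (C * (√((n : ℝ) + 1))⁻¹)) * B := by
    intro n
    -- Use `n + 1` steps of variance `1 / (n + 1)`. The accumulated factor is at most `exp (C / √(n
    -- + 1))`, which tends to `1`.
    have h1 := h ((n + 1 : ℕ) : NNReal)⁻¹ (inv_le_one_of_one_le₀ (by simp)) (n + 1) f g hf hg 0 0
    rw [mul_inv_cancel₀ (by positivity)] at h1
    simp only [zero_add] at h1
    refine h1.trans ?_
    gcongr
    rw [← ENNReal.ofReal_pow (by positivity)]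
    apply ENNReal.ofReal_le_ofReal
    set r := √((n : ℝ) + 1) with hr
    have hr0 : 0 < r := by positivity
    have hr2 : r ^ 2 = n + 1 := Real.sq_sqrt (by positivity)
    have e : √((((n + 1 : ℕ) : NNReal)⁻¹ : NNReal) : ℝ) = r⁻¹ := by
      rw [hr, ← Real.sqrt_inv]; push_cast; rfl
    rw [e]
    calc (1 + C * r⁻¹ ^ 3) ^ (n + 1) ≤ (Real.exp (C * r⁻¹ ^ 3)) ^ (n + 1) := by
          gcongr; linarith [Real.add_one_le_exp (C * r⁻¹ ^ 3)]
      _ = Real.exp (C * r⁻¹) := by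
          rw [← Real.exp_nat_mul]; congr 1; push_cast; rw [← hr2]; field_simp
  have hlim : Tendsto (fun n : ℕ => ENNReal.ofReal (Real.exp (C * (√((n : ℝ) + 1))⁻¹)) * B) atTop
      (𝓝 (ENNReal.ofReal (Real.exp (C * 0)) * B)) := by
    refine ENNReal.Tendsto.mul_const (ENNReal.tendsto_ofReal ?_) (Or.inl (by simp))
    refine (Real.continuous_exp.tendsto _).comp (Tendsto.const_mul C ?_)
    refine tendsto_inv_atTop_zero.comp (Real.tendsto_sqrt_atTop.comp ?_)
    exact tendsto_atTop_add_const_right _ _ tendsto_natCast_atTop_atTop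
  have := ge_of_tendsto' hlim hn
  simpa using this

/-! ### From regular functions to nonnegative measurable functions -/

lemma TaylorBounded.mono {m M L m' M' L' : ℝ} {f : ℝ → ℝ} (hf : TaylorBounded m M L f)
    (hm : m' ≤ m) (hM : M ≤ M') (hL : L ≤ L') : TaylorBounded m' M' L' f where
  continuous := hf.continuous
  lower x := hm.trans (hf.lower x)
  upper x := (hf.upper x).trans hM
  deriv_le x := (hf.deriv_le x).trans hL
  lipschitz x h := (hf.lipschitz x h).trans (by gcongr)
  taylor x h := (hf.taylor x h).trans (by gcongr)

/-- Continuous functions with compact support are bounded, so `g` and its first two derivatives are;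
the mean value inequality then gives the Lipschitz and Taylor estimates. The constant `m` lifts the
function away from zero. -/
lemma exists_taylorBounded_of_contDiff {g : ℝ → ℝ} (hg : ContDiff ℝ 2 g) (hc : HasCompactSupport g)
    (h0 : ∀ x, 0 ≤ g x) (m : ℝ) : ∃ K, TaylorBounded m K K (fun x => g x + m) := by
  have hd : Differentiable ℝ g := hg.differentiable (by norm_num)
  have hg' : ContDiff ℝ 1 (deriv g) := by
    have := (contDiff_succ_iff_deriv (n := 1) (f := g)).1 (by simpa [one_add_one_eq_two] using hg)
    exact this.2.2
  have hd' : Differentiable ℝ (deriv g) := hg'.differentiable (by norm_num)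
  have hc' : HasCompactSupport (deriv g) := hc.deriv
  obtain ⟨K0, hK0⟩ := hg.continuous.bounded_above_of_compact_support hc
  obtain ⟨K1, hK1⟩ := hg'.continuous.bounded_above_of_compact_support hc'
  obtain ⟨K2, hK2⟩ := (hg'.continuous_deriv le_rfl).bounded_above_of_compact_support hc'.deriv
  have hder : ∀ x, deriv (fun x => g x + m) x = deriv g x := fun x => by simp
  have hK20 : 0 ≤ K2 := (norm_nonneg _).trans (hK2 0)
  have hlip : ∀ x h, |g (x + h) - g x| ≤ K1 * |h| := fun x h => by
    have := convex_univ.norm_image_sub_le_of_norm_deriv_le (fun y _ => hd y) (fun y _ => hK1 y)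
      (Set.mem_univ x) (Set.mem_univ (x + h))
    simpa using this
  have hlip' : ∀ x y, |deriv g y - deriv g x| ≤ K2 * |y - x| := fun x y => by
    have := convex_univ.norm_image_sub_le_of_norm_deriv_le (fun y _ => hd' y) (fun y _ => hK2 y)
      (Set.mem_univ x) (Set.mem_univ y)
    simpa using this
  have htay : ∀ x h, |g (x + h) - g x - deriv g x * h| ≤ K2 * h ^ 2 := fun x h => by
    have hdφ : ∀ y, HasDerivAt (fun y => g y - deriv g x * y) (deriv g y - deriv g x) y := fun y => by
      simpa using (hd y).hasDerivAt.fun_sub ((hasDerivAt_id y).const_mul (deriv g x))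
    have := (convex_uIcc x (x + h)).norm_image_sub_le_of_norm_deriv_le
      (f := fun y => g y - deriv g x * y) (C := K2 * |h|) (fun y _ => (hdφ y).differentiableAt)
      (fun y hy => by
        rw [(hdφ y).deriv, Real.norm_eq_abs]
        have := Set.abs_sub_left_of_mem_uIcc hy
        rw [add_sub_cancel_left] at this
        exact (hlip' x y).trans (mul_le_mul_of_nonneg_left this hK20))
      Set.left_mem_uIcc Set.right_mem_uIcc
    simp only [Real.norm_eq_abs, add_sub_cancel_left] at this
    calc _ = |g (x + h) - deriv g x * (x + h) - (g x - deriv g x * x)| := by congr 1; ring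
      _ ≤ K2 * |h| * |h| := this
      _ = K2 * h ^ 2 := by rw [mul_assoc, ← sq, sq_abs]
  set K := max (K0 + m) (max K1 K2)
  have h1 : K1 ≤ K := (le_max_left _ _).trans (le_max_right _ _)
  have h2 : K2 ≤ K := (le_max_right _ _).trans (le_max_right _ _)
  refine ⟨K, ⟨by have := hg.continuous; fun_prop, fun x => by linarith [h0 x], fun x => ?_,
    fun x => ?_, fun x h => ?_, fun x h => ?_⟩⟩
  · have := (le_abs_self _).trans (hK0 x)
    exact (by linarith : g x + m ≤ K0 + m).trans (le_max_left _ _)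
  · rw [hder]; exact (hK1 x).trans h1
  · rw [add_sub_add_right_eq_sub]
    exact (hlip x h).trans (by gcongr)
  · rw [hder, add_sub_add_right_eq_sub]
    exact (htay x h).trans (by gcongr)

/-- Approximation of an integrable function by regular ones, almost everywhere and with control of
the integrals. -/
lemma exists_approx {μ : Measure ℝ} [IsProbabilityMeasure μ] {F : ℝ → ℝ≥0∞} (hF : Measurable F)
    (hfin : ∫⁻ x, F x ∂μ ≠ ∞) :
    ∃ (f : ℕ → ℝ → ℝ) (c : ℕ → ℝ≥0∞), (∀ k, ∃ m > 0, ∃ K, TaylorBounded m K K (f k)) ∧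
      (∀ᵐ x ∂μ, Tendsto (fun k => ENNReal.ofReal (f k x)) atTop (𝓝 (F x))) ∧
      Tendsto c atTop (𝓝 (∫⁻ x, F x ∂μ)) ∧ ∀ k, ENNReal.ofReal (∫ x, f k x ∂μ) ≤ c k := by
  have hFae : ∀ᵐ x ∂μ, F x < ∞ := ae_lt_top hF hfin
  -- Approximating the square root in `L²` and squaring afterwards keeps the approximants
  -- nonnegative; the added `ε k` makes them bounded below by a positive number.
  set φ : ℝ → ℝ := fun x => √(F x).toReal with hφ
  have hφm : Measurable φ := hF.ennreal_toReal.sqrt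
  have hsq : ∀ ψ : ℝ → ℝ, ∫⁻ x, ENNReal.ofReal (ψ x ^ 2) ∂μ = eLpNorm ψ 2 μ ^ 2 := fun ψ => by
    have h := eLpNorm_nnreal_pow_eq_lintegral (f := ψ) (μ := μ) (p := 2) (by norm_num)
    norm_num at h
    rw [h]
    refine lintegral_congr fun x => ?_
    rw [← ENNReal.rpow_natCast, Real.enorm_eq_ofReal_abs, ENNReal.ofReal_rpow_of_nonneg (abs_nonneg _)
      (by norm_num)]
    simp
  have hφF : eLpNorm φ 2 μ ^ 2 = ∫⁻ x, F x ∂μ := by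
    rw [← hsq]
    refine lintegral_congr_ae ?_
    filter_upwards [hFae] with x hx
    rw [hφ]
    simp only
    rw [Real.sq_sqrt ENNReal.toReal_nonneg, ENNReal.ofReal_toReal hx.ne]
  have hφL : MemLp φ 2 μ := by
    refine ⟨hφm.aestronglyMeasurable, ?_⟩
    rw [lt_top_iff_ne_top]
    intro h
    rw [h] at hφF
    simp at hφF
    exact hfin hφF.symm
  have hε : ∀ k : ℕ, (0 : ℝ) < 1 / ((k : ℝ) + 1) := fun k => by positivity
  choose g hgc hgd hgn using fun k : ℕ => hφL.exist_eLpNorm_sub_le (by simp) (by norm_num) (hε k)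
  have hε0 : Tendsto (fun k : ℕ => ENNReal.ofReal (1 / ((k : ℝ) + 1))) atTop (𝓝 0) := by
    simpa using ENNReal.tendsto_ofReal (tendsto_one_div_add_atTop_nhds_zero_nat (𝕜 := ℝ))
  have hgm : ∀ k, AEStronglyMeasurable (g k) μ := fun k => (hgd k).continuous.aestronglyMeasurable
  have hmeas : TendstoInMeasure μ g atTop φ := by
    refine tendstoInMeasure_of_tendsto_eLpNorm (p := 2) (by norm_num) hgm
      hφm.aestronglyMeasurable ?_
    refine tendsto_of_tendsto_of_tendsto_of_le_of_le tendsto_const_nhds hε0 (fun _ => zero_le) ?_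
    intro k
    simp only
    rw [eLpNorm_sub_comm]
    exact hgn k
  obtain ⟨ns, hns, hae⟩ := hmeas.exists_seq_tendsto_ae
  set ε : ℕ → ℝ := fun k => 1 / ((ns k : ℝ) + 1)
  have hεns : Tendsto (fun k => ENNReal.ofReal (ε k)) atTop (𝓝 0) := hε0.comp hns.tendsto_atTop
  refine ⟨fun k x => g (ns k) x ^ 2 + ε k,
    fun k => (eLpNorm φ 2 μ + ENNReal.ofReal (ε k)) ^ 2 + ENNReal.ofReal (ε k), fun k => ?_, ?_, ?_,
    fun k => ?_⟩
  · refine ⟨ε k, hε _, ?_⟩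
    refine exists_taylorBounded_of_contDiff (g := fun x => g (ns k) x ^ 2) ?_ ?_
      (fun x => sq_nonneg _) _
    · exact (contDiff_infty.1 (hgd (ns k)) 2).pow 2
    · simp only [sq]
      exact (hgc (ns k)).mul_left
  · filter_upwards [hae, hFae] with x hx hx'
    have hεr : Tendsto ε atTop (𝓝 0) :=
      (tendsto_one_div_add_atTop_nhds_zero_nat (𝕜 := ℝ)).comp hns.tendsto_atTop
    have := ENNReal.tendsto_ofReal ((hx.pow 2).add hεr)
    rw [add_zero, hφ] at this
    simp only at this
    rwa [Real.sq_sqrt ENNReal.toReal_nonneg, ENNReal.ofReal_toReal hx'.ne] at this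
  · have h1 : Tendsto (fun k => (eLpNorm φ 2 μ + ENNReal.ofReal (ε k)) ^ 2 + ENNReal.ofReal (ε k))
        atTop (𝓝 ((eLpNorm φ 2 μ + 0) ^ 2 + 0)) :=
      (ENNReal.Tendsto.pow (tendsto_const_nhds.add hεns)).add hεns
    rwa [add_zero, add_zero, hφF] at h1
  · have hi : Integrable (fun x => g (ns k) x ^ 2) μ := by
      have : MemLp (g (ns k)) 2 μ := (hgd (ns k)).continuous.memLp_of_hasCompactSupport (hgc (ns k))
      exact this.integrable_sq
    rw [integral_add hi (integrable_const _), integral_const, probReal_univ, one_smul,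
      ENNReal.ofReal_add (integral_nonneg fun x => sq_nonneg _) (hε _).le,
      ofReal_integral_eq_lintegral_ofReal hi (ae_of_all _ fun x => sq_nonneg _), hsq]
    beta_reduce
    gcongr
    calc eLpNorm (g (ns k)) 2 μ = eLpNorm (φ - (φ - g (ns k))) 2 μ := by simp
      _ ≤ eLpNorm φ 2 μ + eLpNorm (φ - g (ns k)) 2 μ :=
        eLpNorm_sub_le hφm.aestronglyMeasurable
          (hφm.aestronglyMeasurable.sub (hgm _)) (by norm_num)
      _ ≤ _ := by gcongr; exact hgn _

/-- The two-function form of hypercontractivity for a measure `μ` and a "noise" map `T`, with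
exponents `a = 1 / p` and `b = 1 / r'`. -/
def TwoFunctionIneq {α : Type*} [MeasurableSpace α] (μ : Measure α) (T : α → α → α) (a b : ℝ) :
    Prop :=
  ∀ F G : α → ℝ≥0∞, Measurable F → Measurable G →
    ∫⁻ w, ∫⁻ z, F w ^ a * G (T w z) ^ b ∂μ ∂μ ≤ (∫⁻ x, F x ∂μ) ^ a * (∫⁻ x, G x ∂μ) ^ b

/-- Two-function Gaussian hypercontractivity in dimension one. -/
theorem twoFunctionIneq_gaussianReal {a b ρ ρ' : ℝ} (ha : 0 < a) (ha1 : a < 1) (hb : 0 < b)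
    (hb1 : b < 1) (hρρ' : ρ ^ 2 + ρ' ^ 2 = 1) (hρ : a * b * ρ ^ 2 ≤ (1 - a) * (1 - b)) :
    TwoFunctionIneq (gaussianReal 0 1) (fun w z => ρ * w + ρ' * z) a b := by
  intro F G hF hG
  set γ := gaussianReal 0 1
  have hmp := measurePreserving_rotate hρρ' 1
  have hmp1 : MeasurePreserving (Prod.fst : ℝ × ℝ → ℝ) (γ.prod γ) γ := measurePreserving_fst
  have hmeasprod : ∀ F G : ℝ → ℝ≥0∞, Measurable F → Measurable G →
      Measurable fun w : ℝ × ℝ => F w.1 ^ a * G (ρ * w.1 + ρ' * w.2) ^ b := fun F G hF hG =>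
    ((hF.comp measurable_fst).pow_const a).mul
      ((hG.comp (by fun_prop : Measurable fun w : ℝ × ℝ => ρ * w.1 + ρ' * w.2)).pow_const b)
  have hprod : ∀ F G : ℝ → ℝ≥0∞, Measurable F → Measurable G →
      ∫⁻ w, ∫⁻ z, F w ^ a * G (ρ * w + ρ' * z) ^ b ∂γ ∂γ =
        ∫⁻ w : ℝ × ℝ, F w.1 ^ a * G (ρ * w.1 + ρ' * w.2) ^ b ∂(γ.prod γ) := fun F G hF hG =>
    (lintegral_prod _ (hmeasprod F G hF hG).aemeasurable).symm
  rw [hprod F G hF hG]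
  -- The degenerate cases come first: if an integral vanishes, the left side is zero; otherwise, if
  -- one is infinite, the right side is infinite. Approximation then concerns finite integrals only.
  by_cases hF0 : ∫⁻ x, F x ∂γ = 0
  · have h1 : ∀ᵐ x ∂γ, F x = 0 := (lintegral_eq_zero_iff hF).1 hF0
    have h2 := hmp1.quasiMeasurePreserving.ae h1
    rw [lintegral_congr_ae (g := fun _ => 0)]
    · simp
    · filter_upwards [h2] with w hw
      rw [hw, ENNReal.zero_rpow_of_pos ha, zero_mul]
  by_cases hG0 : ∫⁻ x, G x ∂γ = 0
  · have h1 : ∀ᵐ x ∂γ, G x = 0 := (lintegral_eq_zero_iff hG).1 hG0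
    have h2 := hmp.quasiMeasurePreserving.ae h1
    rw [lintegral_congr_ae (g := fun _ => 0)]
    · simp
    · filter_upwards [h2] with w hw
      rw [hw, ENNReal.zero_rpow_of_pos hb, mul_zero]
  by_cases hFt : ∫⁻ x, F x ∂γ = ∞
  · rw [hFt, ENNReal.top_rpow_of_pos ha, ENNReal.top_mul]
    · exact le_top
    · simp [ENNReal.rpow_eq_zero_iff, hG0, hb.le]
  by_cases hGt : ∫⁻ x, G x ∂γ = ∞
  · rw [hGt, ENNReal.top_rpow_of_pos hb, ENNReal.mul_top]
    · exact le_top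
    · simp [ENNReal.rpow_eq_zero_iff, hF0, ha.le]
  obtain ⟨f, c, hf, hfae, hc, hfc⟩ := exists_approx (μ := γ) hF hFt
  obtain ⟨g, e, hg, hgae, he, hge⟩ := exists_approx (μ := γ) hG hGt
  have hlim : ∀ᵐ w ∂(γ.prod γ), Tendsto (fun k => ENNReal.ofReal (f k w.1) ^ a *
      ENNReal.ofReal (g k (ρ * w.1 + ρ' * w.2)) ^ b) atTop
      (𝓝 (F w.1 ^ a * G (ρ * w.1 + ρ' * w.2) ^ b)) := by
    filter_upwards [hmp1.quasiMeasurePreserving.ae hfae, hmp.quasiMeasurePreserving.ae hgae,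
      hmp1.quasiMeasurePreserving.ae (ae_lt_top hF hFt),
      hmp.quasiMeasurePreserving.ae (ae_lt_top hG hGt)] with w h1 h2 h3 h4
    refine ENNReal.Tendsto.mul (h1.ennrpow_const a) (Or.inr ?_) (h2.ennrpow_const b) (Or.inr ?_)
    · exact ENNReal.rpow_ne_top_of_nonneg hb.le h4.ne
    · exact ENNReal.rpow_ne_top_of_nonneg ha.le h3.ne
  have hfm : ∀ k, Measurable fun x => ENNReal.ofReal (f k x) := fun k => by
    obtain ⟨m, -, K, h⟩ := hf k
    exact h.continuous.measurable.ennreal_ofReal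
  have hgm : ∀ k, Measurable fun x => ENNReal.ofReal (g k x) := fun k => by
    obtain ⟨m, -, K, h⟩ := hg k
    exact h.continuous.measurable.ennreal_ofReal
  have hbound : ∀ k, ∫⁻ w : ℝ × ℝ, ENNReal.ofReal (f k w.1) ^ a *
      ENNReal.ofReal (g k (ρ * w.1 + ρ' * w.2)) ^ b ∂(γ.prod γ) ≤ c k ^ a * e k ^ b := by
    intro k
    obtain ⟨m, hm, K, hfk⟩ := hf k
    obtain ⟨m', hm', K', hgk⟩ := hg k
    have h1 := TaylorBounded.lintegral_mul_le ha ha1 hb hb1 hρρ' hρ (lt_min hm hm')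
      (hfk.mono (min_le_left m m') (le_max_left K K') (le_max_left K K'))
      (hgk.mono (min_le_right m m') (le_max_right K K') (le_max_right K K'))
    have hf0 : ∀ x, 0 ≤ f k x := fun x => hm.le.trans (hfk.lower x)
    have hg0 : ∀ x, 0 ≤ g k x := fun x => hm'.le.trans (hgk.lower x)
    rw [← hprod (fun x => ENNReal.ofReal (f k x)) (fun x => ENNReal.ofReal (g k x)) (hfm k) (hgm k)]
    calc _ = ∫⁻ w, ∫⁻ z, ENNReal.ofReal (f k w ^ a * g k (ρ * w + ρ' * z) ^ b) ∂γ ∂γ := by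
          refine lintegral_congr fun w => lintegral_congr fun z => ?_
          rw [ENNReal.ofReal_mul (Real.rpow_nonneg (hf0 _) _),
            ENNReal.ofReal_rpow_of_nonneg (hf0 _) ha.le,
            ENNReal.ofReal_rpow_of_nonneg (hg0 _) hb.le]
      _ ≤ _ := h1
      _ = ENNReal.ofReal (∫ x, f k x ∂γ) ^ a * ENNReal.ofReal (∫ x, g k x ∂γ) ^ b := by
          have i1 : 0 ≤ ∫ x, f k x ∂γ := integral_nonneg hf0
          have i2 : 0 ≤ ∫ x, g k x ∂γ := integral_nonneg hg0
          rw [ENNReal.ofReal_mul (Real.rpow_nonneg i1 _), ENNReal.ofReal_rpow_of_nonneg i1 ha.le,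
            ENNReal.ofReal_rpow_of_nonneg i2 hb.le]
      _ ≤ _ := by gcongr; exacts [hfc k, hge k]
  -- Fatou's lemma: almost everywhere convergence suffices on the left, and the bounds `c k`, `e k`
  -- converge on the right.
  calc _ = ∫⁻ w, liminf (fun k => ENNReal.ofReal (f k w.1) ^ a *
      ENNReal.ofReal (g k (ρ * w.1 + ρ' * w.2)) ^ b) atTop ∂(γ.prod γ) :=
        lintegral_congr_ae (hlim.mono fun w hw => hw.liminf_eq.symm)
    _ ≤ liminf (fun k => ∫⁻ w : ℝ × ℝ, ENNReal.ofReal (f k w.1) ^ a *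
      ENNReal.ofReal (g k (ρ * w.1 + ρ' * w.2)) ^ b ∂(γ.prod γ)) atTop :=
        lintegral_liminf_le fun k => hmeasprod _ _ (hfm k) (hgm k)
    _ ≤ liminf (fun k => c k ^ a * e k ^ b) atTop := liminf_le_liminf (Eventually.of_forall hbound)
    _ = _ := by
        refine Tendsto.liminf_eq (ENNReal.Tendsto.mul (hc.ennrpow_const a) (Or.inr ?_)
          (he.ennrpow_const b) (Or.inr ?_))
        · exact ENNReal.rpow_ne_top_of_nonneg hb.le hGt
        · exact ENNReal.rpow_ne_top_of_nonneg ha.le hFt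

/-! ### Tensorisation and duality -/

namespace TwoFunctionIneq

variable {α β : Type*} [MeasurableSpace α] [MeasurableSpace β] {μ : Measure α} {ν : Measure β}
  {T : α → α → α} {S : β → β → β} {a b : ℝ}

/-- By Fubini, apply the inequality for `ν` with the first coordinates frozen, then the inequality
for `μ` to the partial integrals of `F` and `G`. The constant one is what makes induction on the
dimension lossless. -/
lemma prod [SFinite μ] [SFinite ν] (hμ : TwoFunctionIneq μ T a b) (hν : TwoFunctionIneq ν S a b)
    (hT : Measurable (Function.uncurry T)) (hS : Measurable (Function.uncurry S)) :
    TwoFunctionIneq (μ.prod ν) (fun w z => (T w.1 z.1, S w.2 z.2)) a b := by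
  intro F G hF hG
  have hT' : Measurable fun y : (α × β) × (α × β) => T y.1.1 y.2.1 :=
    hT.comp (by fun_prop : Measurable fun y : (α × β) × (α × β) => (y.1.1, y.2.1))
  have hS' : Measurable fun y : (α × β) × (α × β) => S y.1.2 y.2.2 :=
    hS.comp (by fun_prop : Measurable fun y : (α × β) × (α × β) => (y.1.2, y.2.2))
  have hK : Measurable fun y : (α × β) × (α × β) =>
      F y.1 ^ a * G (T y.1.1 y.2.1, S y.1.2 y.2.2) ^ b :=
    ((hF.comp measurable_fst).pow_const a).mul ((hG.comp (hT'.prodMk hS')).pow_const b)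
  have hin : ∀ w₁ z₁, ∫⁻ w₂, ∫⁻ z₂, F (w₁, w₂) ^ a * G (T w₁ z₁, S w₂ z₂) ^ b ∂ν ∂ν ≤
      (∫⁻ y, F (w₁, y) ∂ν) ^ a * (∫⁻ y, G (T w₁ z₁, y) ∂ν) ^ b := fun w₁ z₁ =>
    hν _ _ (hF.comp measurable_prodMk_left) (hG.comp measurable_prodMk_left)
  calc _ = ∫⁻ w₁, ∫⁻ w₂, ∫⁻ z₁, ∫⁻ z₂, F (w₁, w₂) ^ a * G (T w₁ z₁, S w₂ z₂) ^ b
        ∂ν ∂μ ∂ν ∂μ := by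
        rw [lintegral_prod _ hK.lintegral_prod_right'.aemeasurable]
        refine lintegral_congr fun w₁ => lintegral_congr fun w₂ => ?_
        exact lintegral_prod _ (hK.comp (measurable_prodMk_left (x := (w₁, w₂)))).aemeasurable
    _ = ∫⁻ w₁, ∫⁻ z₁, ∫⁻ w₂, ∫⁻ z₂, F (w₁, w₂) ^ a * G (T w₁ z₁, S w₂ z₂) ^ b
        ∂ν ∂ν ∂μ ∂μ := by
        refine lintegral_congr fun w₁ => ?_
        rw [lintegral_lintegral_swap]
        have h1 : Measurable fun y : (β × α) × β => ((w₁, y.1.1), (y.1.2, y.2)) := by fun_prop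
        exact (hK.comp h1).lintegral_prod_right'.aemeasurable
    _ ≤ ∫⁻ w₁, ∫⁻ z₁, (∫⁻ y, F (w₁, y) ∂ν) ^ a * (∫⁻ y, G (T w₁ z₁, y) ∂ν) ^ b ∂μ ∂μ := by
        gcongr with w₁ z₁
        exact hin w₁ z₁
    _ ≤ (∫⁻ x, ∫⁻ y, F (x, y) ∂ν ∂μ) ^ a * (∫⁻ x, ∫⁻ y, G (x, y) ∂ν ∂μ) ^ b :=
        hμ _ _ hF.lintegral_prod_right' hG.lintegral_prod_right'
    _ = _ := by
        rw [lintegral_prod _ hF.aemeasurable, lintegral_prod _ hG.aemeasurable]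

lemma of_equiv (hν : TwoFunctionIneq ν S a b) (e : α ≃ᵐ β) (he : MeasurePreserving e μ ν)
    (hTS : ∀ w z, e (T w z) = S (e w) (e z)) : TwoFunctionIneq μ T a b := by
  intro F G hF hG
  have key : ∀ H : α → ℝ≥0∞, ∫⁻ x, H x ∂μ = ∫⁻ y, H (e.symm y) ∂ν := fun H => by
    rw [← he.map_eq, lintegral_map_equiv]; simp
  have h := hν _ _ (hF.comp e.symm.measurable) (hG.comp e.symm.measurable)
  rw [key F, key G, key]
  refine le_trans (le_of_eq ?_) h
  refine lintegral_congr fun w => ?_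
  rw [key]
  refine lintegral_congr fun z => ?_
  simp only [Function.comp]
  congr 3
  apply e.injective
  simp [hTS]

end TwoFunctionIneq

/-- Two-function Gaussian hypercontractivity in finite dimension. -/
theorem twoFunctionIneq_pi_gaussianReal {a b ρ ρ' : ℝ} (ha : 0 < a) (ha1 : a < 1) (hb : 0 < b)
    (hb1 : b < 1) (hρρ' : ρ ^ 2 + ρ' ^ 2 = 1) (hρ : a * b * ρ ^ 2 ≤ (1 - a) * (1 - b)) (n : ℕ) :
    TwoFunctionIneq (Measure.pi fun _ : Fin n => gaussianReal 0 1)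
      (fun w z => ρ • w + ρ' • z) a b := by
  induction n with
  | zero =>
    intro F G _ _
    simp only [lintegral_unique, measure_univ, mul_one]
    apply le_of_eq
    congr 2
    exact congrArg G (Subsingleton.elim _ _)
  | succ n ih =>
    have h1 := twoFunctionIneq_gaussianReal ha ha1 hb hb1 hρρ' hρ
    refine TwoFunctionIneq.of_equiv (h1.prod ih ?_ ?_) _
      (measurePreserving_piFinSuccAbove (fun _ : Fin (n + 1) => gaussianReal 0 1) 0) ?_
    · exact (by fun_prop : Measurable fun y : ℝ × ℝ => ρ * y.1 + ρ' * y.2)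
    · exact (by fun_prop : Measurable fun y : (Fin n → ℝ) × (Fin n → ℝ) => ρ • y.1 + ρ' • y.2)
    · intro w z
      ext i
      · simp [MeasurableEquiv.piFinSuccAbove]
      · simp [MeasurableEquiv.piFinSuccAbove]
        rfl

/-- By duality the two-function inequality is hypercontractivity of the averaging operator. -/
lemma TwoFunctionIneq.rpow_lintegral_le {α : Type*} [MeasurableSpace α] {μ : Measure α}
    [IsProbabilityMeasure μ] {T : α → α → α} {p r : ℝ} (hp : 1 < p) (hr : 1 < r)
    (h : TwoFunctionIneq μ T (1 - 1 / r) (1 / p)) (hT : Measurable (Function.uncurry T))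
    {M : α → ℝ≥0∞} (hM : Measurable M) :
    (∫⁻ w, (∫⁻ z, M (T w z) ∂μ) ^ r ∂μ) ^ (1 / r) ≤ (∫⁻ x, M x ^ p ∂μ) ^ (1 / p) := by
  have hr0 : 0 < r := by linarith
  have hp0 : 0 < p := by linarith
  set S : α → ℝ≥0∞ := fun w => ∫⁻ z, M (T w z) ∂μ
  have hS : Measurable S := (hM.comp hT).lintegral_prod_right'
  set B := (∫⁻ x, M x ^ p ∂μ) ^ (1 / p)
  have key : ∀ k : ℕ, ∫⁻ w, (min (S w) k) ^ r ∂μ ≤ B ^ r := by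
    intro k
    set A := ∫⁻ w, (min (S w) k) ^ r ∂μ with hA
    have hm : Measurable fun w => (min (S w) k) ^ r := (hS.min measurable_const).pow_const r
    -- Test the inequality with the truncated `F = min (S, k) ^ r` and `G = M ^ p`. The truncation
    -- keeps `A` finite, so that `A ^ (1 - 1 / r)` may be cancelled.
    have h1 : A ≤ A ^ (1 - 1 / r) * B := by
      calc A ≤ ∫⁻ w, ∫⁻ z, ((min (S w) k) ^ r) ^ (1 - 1 / r) * (M (T w z) ^ p) ^ (1 / p) ∂μ ∂μ := by
            refine lintegral_mono fun w => ?_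
            have e1 : ((min (S w) k) ^ r) ^ (1 - 1 / r) = (min (S w) k) ^ (r - 1) := by
              rw [← ENNReal.rpow_mul]; congr 1; field_simp
            have e2 : ∀ z, (M (T w z) ^ p) ^ (1 / p) = M (T w z) := fun z => by
              rw [← ENNReal.rpow_mul, mul_one_div_cancel hp0.ne', ENNReal.rpow_one]
            simp_rw [e1, e2]
            refine le_trans ?_ (lintegral_const_mul _
              (hM.comp (hT.comp (measurable_prodMk_left (x := w))))).ge
            calc _ = (min (S w) k) ^ (r - 1) * (min (S w) k) := by
                  conv_lhs => rw [show r = (r - 1) + 1 by ring]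
                  rw [ENNReal.rpow_add_of_nonneg _ _ (by linarith) zero_le_one, ENNReal.rpow_one]
              _ ≤ _ := by gcongr; exact min_le_left _ _
        _ ≤ _ := h _ _ hm (hM.pow_const p)
    have hAfin : A ≠ ∞ := by
      refine ne_top_of_le_ne_top (b := (k : ℝ≥0∞) ^ r) (by simp [hr0.le]) ?_
      calc A ≤ ∫⁻ _, (k : ℝ≥0∞) ^ r ∂μ := by
            refine lintegral_mono fun w => ?_
            exact ENNReal.rpow_le_rpow (min_le_right _ _) hr0.le
        _ = _ := by simp
    rcases eq_or_ne A 0 with h0 | h0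
    · rw [h0]; exact zero_le
    · have h2 : A ^ (1 / r) ≤ B := by
        have h3 : A ^ (1 - 1 / r) * A ^ (1 / r) ≤ A ^ (1 - 1 / r) * B := by
          rw [← ENNReal.rpow_add _ _ h0 hAfin, sub_add_cancel, ENNReal.rpow_one]; exact h1
        rwa [ENNReal.mul_le_mul_iff_right] at h3
        · simp [ENNReal.rpow_eq_zero_iff, h0, hAfin]
        · exact ENNReal.rpow_ne_top_of_ne_zero h0 hAfin
      calc A = (A ^ (1 / r)) ^ r := by
            rw [← ENNReal.rpow_mul, one_div_mul_cancel hr0.ne', ENNReal.rpow_one]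
        _ ≤ _ := by gcongr
  have hlim : ∀ w, Tendsto (fun k : ℕ => (min (S w) k) ^ r) atTop (𝓝 (S w ^ r)) := fun w => by
    have : Tendsto (fun k : ℕ => min (S w) (k : ℝ≥0∞)) atTop (𝓝 (min (S w) ∞)) :=
      tendsto_const_nhds.min ENNReal.tendsto_nat_nhds_top
    rw [min_eq_left le_top] at this
    exact this.ennrpow_const r
  have : ∫⁻ w, S w ^ r ∂μ ≤ B ^ r := by
    calc _ = ∫⁻ w, liminf (fun k : ℕ => (min (S w) k) ^ r) atTop ∂μ :=
          lintegral_congr fun w => (hlim w).liminf_eq.symm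
      _ ≤ liminf (fun k : ℕ => ∫⁻ w, (min (S w) k) ^ r ∂μ) atTop :=
          lintegral_liminf_le fun k => (hS.min measurable_const).pow_const r
      _ ≤ liminf (fun _ : ℕ => B ^ r) atTop := liminf_le_liminf (Eventually.of_forall key)
      _ = _ := liminf_const _
  calc _ ≤ (B ^ r) ^ (1 / r) := by gcongr
    _ = B := by rw [← ENNReal.rpow_mul, mul_one_div_cancel hr0.ne', ENNReal.rpow_one]

/-- Gaussian hypercontractivity for averages of nonnegative functions. -/
theorem gaussian_hypercontractive {p r ρ ρ' : ℝ} (hp : 1 < p) (hr : 1 < r)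
    (hρρ' : ρ ^ 2 + ρ' ^ 2 = 1) (hρ : ρ ^ 2 ≤ (p - 1) / (r - 1)) {n : ℕ}
    {M : (Fin n → ℝ) → ℝ≥0∞} (hM : Measurable M) :
    (∫⁻ w, (∫⁻ z, M (ρ • w + ρ' • z) ∂(Measure.pi fun _ : Fin n => gaussianReal 0 1)) ^ r
      ∂(Measure.pi fun _ : Fin n => gaussianReal 0 1)) ^ (1 / r) ≤
      (∫⁻ x, M x ^ p ∂(Measure.pi fun _ : Fin n => gaussianReal 0 1)) ^ (1 / p) := by
  have hp' : 1 / p < 1 := by rw [div_lt_one (by linarith)]; exact hp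
  have hr' : 1 / r < 1 := by rw [div_lt_one (by linarith)]; exact hr
  have hr0 : 0 < 1 / r := by positivity
  refine (twoFunctionIneq_pi_gaussianReal (sub_pos.2 hr') (by linarith) (by positivity) hp'
    hρρ' ?_ n).rpow_lintegral_le hp hr ?_ hM
  -- With `a = 1 - 1 / r` and `b = 1 / p`, the condition on `ρ` becomes `ρ² (r - 1) ≤ p - 1` after
  -- clearing `r p`.
  · rw [le_div_iff₀ (by linarith)] at hρ
    have hpp : 0 < p := by linarith
    have hrr : 0 < r := by linarith
    have e1 : (1 - 1 / r) * (1 / p) * ρ ^ 2 = (ρ ^ 2 * (r - 1)) * (1 / (r * p)) := by field_simp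
    have e2 : (1 - (1 - 1 / r)) * (1 - 1 / p) = (p - 1) * (1 / (r * p)) := by field_simp; ring
    rw [e1, e2]
    gcongr
  · exact (by fun_prop : Measurable fun y : (Fin n → ℝ) × (Fin n → ℝ) => ρ • y.1 + ρ' • y.2)

/-! ### Polynomial extrapolation and Ornstein–Uhlenbeck averages -/

lemma prod_erase_abs_sub {d j : ℕ} (hj : j ≤ d) :
    ∏ i ∈ (Finset.range (d + 1)).erase j, |(j : ℝ) - i| = j.factorial * (d - j).factorial := by
  have hsplit : (Finset.range (d + 1)).erase j = Finset.range j ∪ Finset.Ico (j + 1) (d + 1) := by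
    ext i; simp; omega
  have hdisj : Disjoint (Finset.range j) (Finset.Ico (j + 1) (d + 1)) := by
    rw [Finset.disjoint_left]; intro i hi hi'; simp at hi hi'; omega
  rw [hsplit, Finset.prod_union hdisj]
  congr 1
  · rw [← Finset.prod_range_add_one_eq_factorial, ← Finset.prod_range_reflect, Nat.cast_prod]
    refine Finset.prod_congr rfl fun i hi => ?_
    have hi' := Finset.mem_range.1 hi
    have e : (j : ℝ) - ((j - 1 - i : ℕ) : ℝ) = ((i + 1 : ℕ) : ℝ) := by
      rw [← Nat.cast_sub (by omega)]; congr 1; omega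
    rw [e, Nat.abs_cast]
  · rw [Finset.prod_Ico_eq_prod_range, ← Finset.prod_range_add_one_eq_factorial, Nat.cast_prod]
    refine Finset.prod_congr (by congr 1; omega) fun i _ => ?_
    rw [abs_sub_comm, abs_of_nonneg (by push_cast; linarith [(Nat.cast_nonneg i : (0 : ℝ) ≤ i)])]
    push_cast; ring

/-- This is `d ^ d / d! ≤ 2 ^ (d² / 2)` squared, to stay with integer exponents. In the induction `d
+ 1 ≤ 2 d` suffices, since `(d + 1)² = d² + 2 d + 1`. -/
lemma pow_self_sq_le (d : ℕ) : ((d : ℝ) ^ d) ^ 2 ≤ 2 ^ (d ^ 2) * (d.factorial : ℝ) ^ 2 := by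
  induction d with
  | zero => simp
  | succ d ih =>
    rcases Nat.eq_zero_or_pos d with rfl | hd
    · norm_num
    have hd1 : (1 : ℝ) ≤ d := by exact_mod_cast hd
    have h1 : (((d : ℝ) + 1) ^ d) ^ 2 ≤ 2 ^ (2 * d + 1) * ((d : ℝ) ^ d) ^ 2 := by
      calc (((d : ℝ) + 1) ^ d) ^ 2 ≤ ((2 * (d : ℝ)) ^ d) ^ 2 := by gcongr; linarith
        _ = 2 ^ (2 * d) * ((d : ℝ) ^ d) ^ 2 := by rw [mul_pow]; ring
        _ ≤ _ := by gcongr <;> norm_num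
    push_cast [Nat.factorial_succ]
    calc (((d : ℝ) + 1) ^ (d + 1)) ^ 2 = (d + 1) ^ 2 * (((d : ℝ) + 1) ^ d) ^ 2 := by ring
      _ ≤ (d + 1) ^ 2 * (2 ^ (2 * d + 1) * ((d : ℝ) ^ d) ^ 2) := by gcongr
      _ ≤ (d + 1) ^ 2 * (2 ^ (2 * d + 1) * (2 ^ (d ^ 2) * (d.factorial : ℝ) ^ 2)) := by gcongr
      _ = _ := by ring

/-- Extrapolation from equally spaced nodes in `[0, ρ]` to the point `1`. -/
lemma exists_extrapolation (d : ℕ) {ρ : ℝ} (hρ : 0 < ρ) (hρ1 : ρ ≤ 1) :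
    ∃ (v c : ℕ → ℝ), (∀ j ∈ Finset.range (d + 1), 0 ≤ v j ∧ v j ≤ ρ) ∧
      (∀ f : Polynomial ℝ, f.natDegree ≤ d → f.eval 1 = ∑ j ∈ Finset.range (d + 1), c j * f.eval (v j)) ∧
      ∑ j ∈ Finset.range (d + 1), |c j| ≤ 2 ^ ((d : ℝ) ^ 2 / 2 + d) * (ρ ^ d)⁻¹ := by
  rcases Nat.eq_zero_or_pos d with rfl | hd
  · refine ⟨fun _ => 0, fun _ => 1, by simp [hρ.le], fun f hf => ?_, by simp⟩
    rw [Polynomial.eq_C_of_natDegree_le_zero hf]; simp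
  have hd0 : (0 : ℝ) < d := by exact_mod_cast hd
  -- For these nodes the Lagrange weight at `1` is at most `(d / ρ) ^ d / (j! (d - j)!)`, because
  -- every numerator `|1 - v i|` is at most `1`. Summing binomial coefficients gives `(d / ρ) ^ d *
  -- 2 ^ d / d!`. Degree zero was treated apart because the nodes divide by `d`.
  let v : ℕ → ℝ := fun j => ρ * j / d
  let s := Finset.range (d + 1)
  have hv : ∀ j ∈ s, 0 ≤ v j ∧ v j ≤ ρ := fun j hj => by
    refine ⟨by positivity, ?_⟩
    rw [div_le_iff₀ hd0]
    gcongr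
    have := Finset.mem_range.1 hj
    omega
  have hinj : Set.InjOn v s := fun i _ j _ hij => by
    have : ρ * (i : ℝ) / d = ρ * j / d := hij
    rw [div_left_inj' hd0.ne', mul_right_inj' hρ.ne'] at this
    exact_mod_cast this
  refine ⟨v, fun j => (Lagrange.basis s v j).eval 1, hv, fun f hf => ?_, ?_⟩
  · have hdeg : f.degree < (s.card : WithBot ℕ) := by
      rw [Finset.card_range]
      exact (Polynomial.degree_le_of_natDegree_le hf).trans_lt (by exact_mod_cast Nat.lt_succ_self d)
    conv_lhs => rw [Lagrange.eq_interpolate hinj hdeg, Lagrange.interpolate_apply]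
    rw [Polynomial.eval_finsetSum]
    refine Finset.sum_congr rfl fun j _ => ?_
    simp [mul_comm]
  · have hb : ∀ j ∈ s, |(Lagrange.basis s v j).eval 1| ≤
        (d / ρ) ^ d * ((d.choose j : ℝ) / d.factorial) := by
      intro j hj
      have hjd : j ≤ d := Nat.lt_succ_iff.1 (Finset.mem_range.1 hj)
      rw [Lagrange.basis, Polynomial.eval_prod, Finset.abs_prod]
      have hfac : (d.choose j : ℝ) / d.factorial = ((j.factorial : ℝ) * (d - j).factorial)⁻¹ := by
        have h1 : (0 : ℝ) < d.factorial := by exact_mod_cast d.factorial_pos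
        have h2 : (0 : ℝ) < j.factorial := by exact_mod_cast j.factorial_pos
        have h3 : (0 : ℝ) < (d - j).factorial := by exact_mod_cast (d - j).factorial_pos
        have h4 : (d.choose j : ℝ) * j.factorial * (d - j).factorial = d.factorial := by
          exact_mod_cast Nat.choose_mul_factorial_mul_factorial hjd
        rw [div_eq_iff h1.ne', ← h4]; field_simp
      have hcard : (s.erase j).card = d := by
        rw [Finset.card_erase_of_mem hj, Finset.card_range, Nat.add_sub_cancel]
      rw [hfac, ← prod_erase_abs_sub hjd, ← Finset.prod_inv_distrib]
      have hpow : (d / ρ) ^ d = ∏ _i ∈ s.erase j, (d / ρ) := by rw [Finset.prod_const, hcard]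
      rw [hpow, ← Finset.prod_mul_distrib]
      refine Finset.prod_le_prod (fun _ _ => abs_nonneg _) fun i hi => ?_
      have hi' := Finset.mem_of_mem_erase hi
      rw [Lagrange.basisDivisor]
      simp only [Polynomial.eval_mul, Polynomial.eval_C, Polynomial.eval_sub, Polynomial.eval_X]
      rw [abs_mul, abs_inv]
      have e1 : |v j - v i| = ρ / d * |(j : ℝ) - i| := by
        have : v j - v i = ρ / d * ((j : ℝ) - i) := by simp only [v]; ring
        rw [this, abs_mul, abs_of_pos (by positivity)]
      have e2 : |1 - v i| ≤ 1 := by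
        rw [abs_le]; constructor <;> linarith [(hv i hi').1, (hv i hi').2]
      rw [e1, mul_inv, inv_div]
      exact mul_le_of_le_one_right (by positivity) e2
    have h1 : (0 : ℝ) < d.factorial := by exact_mod_cast d.factorial_pos
    have h2 : (d : ℝ) ^ d / d.factorial ≤ 2 ^ ((d : ℝ) ^ 2 / 2) := by
      rw [div_le_iff₀ h1]
      refine (pow_le_pow_iff_left₀ (by positivity) (by positivity) two_ne_zero).1 ?_
      rw [mul_pow]
      refine (pow_self_sq_le d).trans_eq ?_
      congr 1
      rw [← Real.rpow_natCast, ← Real.rpow_natCast, ← Real.rpow_mul (by norm_num)]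
      congr 1; push_cast; ring
    calc _ ≤ ∑ j ∈ s, (d / ρ) ^ d * ((d.choose j : ℝ) / d.factorial) := Finset.sum_le_sum hb
      _ = (d / ρ) ^ d * (2 ^ d / d.factorial) := by
          rw [← Finset.mul_sum, ← Finset.sum_div]
          congr 2
          exact_mod_cast Nat.sum_range_choose d
      _ = ((d : ℝ) ^ d / d.factorial) * 2 ^ d * (ρ ^ d)⁻¹ := by rw [div_pow]; field_simp
      _ ≤ 2 ^ ((d : ℝ) ^ 2 / 2) * 2 ^ d * (ρ ^ d)⁻¹ := by gcongr
      _ = _ := by rw [Real.rpow_add (by norm_num), Real.rpow_natCast]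

lemma integral_pow_odd_gaussianReal {l : ℕ} (hl : Odd l) :
    ∫ z, z ^ l ∂(gaussianReal 0 1) = 0 := by
  have h : ∫ z, z ^ l ∂(gaussianReal 0 1) = ∫ z, (-z) ^ l ∂(gaussianReal 0 1) := by
    conv_lhs => rw [← neg_zero, ← gaussianReal_map_neg,
      integral_map (by fun_prop) (by fun_prop)]
  simp_rw [hl.neg_pow, integral_neg] at h
  linarith

lemma integrable_affine_pow (c s : ℝ) (k : ℕ) :
    Integrable (fun z : ℝ => (c + s * z) ^ k) (gaussianReal 0 1) := by
  have h : MemLp (fun z : ℝ => c + s * z) k (gaussianReal 0 1) :=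
    (memLp_const c).add ((memLp_id_gaussianReal' (k : ℝ≥0∞) (ENNReal.natCast_ne_top k)).const_mul s)
  refine h.integrable_norm_pow'.mono' (by fun_prop) (ae_of_all _ fun x => ?_)
  simp

/-- Odd Gaussian moments vanish, so `√(1 - t²)` survives only in even powers, which are polynomials
in `t`. A term with `t ^ j` has degree at most `j + 2 ⌊(k - j) / 2⌋ ≤ k`. -/
lemma exists_polynomial_integral_pow (x : ℝ) (k : ℕ) :
    ∃ p : Polynomial ℝ, p.natDegree ≤ k ∧ ∀ t : ℝ, 0 ≤ t → t ≤ 1 →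
      ∫ z, (t * x + √(1 - t ^ 2) * z) ^ k ∂(gaussianReal 0 1) = p.eval t := by
  let m : ℕ → ℝ := fun l => ∫ z, z ^ l ∂(gaussianReal 0 1)
  refine ⟨∑ j ∈ Finset.range (k + 1), Polynomial.C (x ^ j * m (k - j) * k.choose j) *
    (Polynomial.X ^ j * (1 - Polynomial.X ^ 2) ^ ((k - j) / 2)), ?_, fun t ht0 ht1 => ?_⟩
  · refine Polynomial.natDegree_sum_le_of_forall_le _ _ fun j hj => ?_
    have hj' := Finset.mem_range.1 hj
    refine (Polynomial.natDegree_C_mul_le _ _).trans (Polynomial.natDegree_mul_le.trans ?_)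
    have h1 : (1 - Polynomial.X ^ 2 : Polynomial ℝ).natDegree ≤ 2 := by
      refine (Polynomial.natDegree_sub_le _ _).trans ?_
      simp
    have h2 := (Polynomial.natDegree_pow_le (p := (1 - Polynomial.X ^ 2 : Polynomial ℝ))
      (n := (k - j) / 2)).trans (Nat.mul_le_mul_left _ h1)
    rw [Polynomial.natDegree_X_pow]
    omega
  · have hs : √(1 - t ^ 2) ^ 2 = 1 - t ^ 2 := Real.sq_sqrt (by nlinarith)
    set s := √(1 - t ^ 2)
    simp_rw [add_pow]
    rw [integral_finsetSum]
    · rw [Polynomial.eval_finsetSum]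
      refine Finset.sum_congr rfl fun j _ => ?_
      rw [integral_mul_const, integral_const_mul]
      simp_rw [mul_pow]
      rw [integral_const_mul]
      simp only [Polynomial.eval_mul, Polynomial.eval_C, Polynomial.eval_pow, Polynomial.eval_X,
        Polynomial.eval_sub, Polynomial.eval_one]
      rcases Nat.even_or_odd (k - j) with he | ho
      · obtain ⟨l, hl⟩ := he
        have : (k - j) / 2 = l := by omega
        rw [this, ← hs, ← pow_mul, show 2 * l = k - j by omega]
        simp only [m]; ring
      · have : m (k - j) = 0 := integral_pow_odd_gaussianReal ho
        simp only [m] at this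
        simp only [m, this]; ring
    · intro j _
      refine ((Integrable.const_mul ?_ _).mul_const _)
      simpa using integrable_affine_pow 0 s (k - j)

lemma integrable_eval_affine {n : ℕ} (Q : MvPolynomial (Fin n) ℝ) (x : Fin n → ℝ) (t s : ℝ) :
    Integrable (fun z => MvPolynomial.eval (t • x + s • z) Q)
      (Measure.pi fun _ : Fin n => gaussianReal 0 1) := by
  simp_rw [MvPolynomial.eval_eq']
  refine integrable_finsetSum _ fun m _ => Integrable.const_mul ?_ _
  exact Integrable.fintype_prod (f := fun i z => (t * x i + s * z) ^ m i)
    fun i => integrable_affine_pow _ _ _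

/-- The Ornstein–Uhlenbeck average of a polynomial of degree at most `d` is a polynomial of degree
at most `d` in the correlation parameter. -/
lemma exists_polynomial_integral_eval {n d : ℕ} {Q : MvPolynomial (Fin n) ℝ}
    (hQ : Q.totalDegree ≤ d) (x : Fin n → ℝ) :
    ∃ p : Polynomial ℝ, p.natDegree ≤ d ∧ ∀ t : ℝ, 0 ≤ t → t ≤ 1 →
      ∫ z, MvPolynomial.eval (t • x + √(1 - t ^ 2) • z) Q
        ∂(Measure.pi fun _ : Fin n => gaussianReal 0 1) = p.eval t := by
  choose p hpd hp using fun (i : Fin n) (k : ℕ) => exists_polynomial_integral_pow (x i) k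
  refine ⟨∑ m ∈ Q.support, Polynomial.C (Q.coeff m) * ∏ i, p i (m i), ?_, fun t ht0 ht1 => ?_⟩
  · refine Polynomial.natDegree_sum_le_of_forall_le _ _ fun m hm => ?_
    refine (Polynomial.natDegree_C_mul_le _ _).trans ((Polynomial.natDegree_prod_le _ _).trans ?_)
    refine (Finset.sum_le_sum fun i _ => hpd i (m i)).trans ?_
    refine le_trans (le_of_eq ?_) ((MvPolynomial.le_totalDegree hm).trans hQ)
    rw [Finsupp.sum_fintype _ _ (fun _ => rfl)]
  · simp_rw [MvPolynomial.eval_eq']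
    rw [integral_finsetSum, Polynomial.eval_finsetSum]
    · refine Finset.sum_congr rfl fun m _ => ?_
      rw [integral_const_mul, Polynomial.eval_mul, Polynomial.eval_C, Polynomial.eval_prod]
      congr 1
      refine (integral_fintype_prod_eq_prod
        (f := fun i z => (t * x i + √(1 - t ^ 2) * z) ^ m i)).trans ?_
      exact Finset.prod_congr rfl fun i _ => hp i (m i) t ht0 ht1
    · intro m _
      refine Integrable.const_mul ?_ _
      exact Integrable.fintype_prod (f := fun i z => (t * x i + √(1 - t ^ 2) * z) ^ m i)
        fun i => integrable_affine_pow _ _ _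

lemma eLpNorm_ofReal_eq {α : Type*} [MeasurableSpace α] {μ : Measure α} {p : ℝ} (hp : 0 < p)
    (f : α → ℝ≥0∞) : eLpNorm f (ENNReal.ofReal p) μ = (∫⁻ x, f x ^ p ∂μ) ^ (1 / p) := by
  rw [eLpNorm_eq_lintegral_rpow_enorm_toReal (by simpa using hp) (by simp),
    ENNReal.toReal_ofReal hp.le]
  simp

/-- The comparison constant. -/
noncomputable def chaosConst (d : ℕ) (p r : ℝ) : ℝ :=
  (2 : ℝ) ^ ((d : ℝ) ^ 2 / 2 + d) * ((r - 1) / (p - 1)) ^ ((d : ℝ) / 2)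

/-- Comparison of moments for suprema of polynomials in independent standard Gaussian variables. -/
theorem eLpNorm_iSup_eval_le {n d : ℕ} {ι : Type*} [Countable ι]
    {Q : ι → MvPolynomial (Fin n) ℝ} (hQ : ∀ i, (Q i).totalDegree ≤ d) {p r : ℝ} (hp : 1 < p)
    (hpr : p < r) :
    eLpNorm (fun x => ⨆ i, ‖MvPolynomial.eval x (Q i)‖ₑ) (ENNReal.ofReal r)
        (Measure.pi fun _ : Fin n => gaussianReal 0 1) ≤
      ENNReal.ofReal (chaosConst d p r) *
        eLpNorm (fun x => ⨆ i, ‖MvPolynomial.eval x (Q i)‖ₑ) (ENNReal.ofReal p)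
          (Measure.pi fun _ : Fin n => gaussianReal 0 1) := by
  set γ := Measure.pi fun _ : Fin n => gaussianReal 0 1
  set M : (Fin n → ℝ) → ℝ≥0∞ := fun x => ⨆ i, ‖MvPolynomial.eval x (Q i)‖ₑ with hM
  have hMm : Measurable M :=
    Measurable.iSup fun i => (MvPolynomial.continuous_eval (Q i)).measurable.enorm
  have hr : 1 < r := hp.trans hpr
  -- The largest correlation allowed by hypercontractivity from `L^p` to `L^r`; the factor `ρ ^
  -- (-d)` of the extrapolation becomes `((r - 1) / (p - 1)) ^ (d / 2)`.
  set ρ := √((p - 1) / (r - 1)) with hρdef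
  have hq0 : 0 < (p - 1) / (r - 1) := div_pos (by linarith) (by linarith)
  have hρ0 : 0 < ρ := Real.sqrt_pos.2 hq0
  have hρsq : ρ ^ 2 = (p - 1) / (r - 1) := Real.sq_sqrt hq0.le
  have hρ1 : ρ ≤ 1 := by
    rw [hρdef, Real.sqrt_le_one, div_le_one (by linarith)]; linarith
  obtain ⟨v, c, hv, hc, hsum⟩ := exists_extrapolation d hρ0 hρ1
  have hT : ∀ t : ℝ, Measurable fun y : (Fin n → ℝ) × (Fin n → ℝ) =>
      M (t • y.1 + √(1 - t ^ 2) • y.2) := fun t => hMm.comp (by fun_prop)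
  set S : ℕ → (Fin n → ℝ) → ℝ≥0∞ := fun j x => ∫⁻ z, M (v j • x + √(1 - v j ^ 2) • z) ∂γ
  have hSm : ∀ j, Measurable (S j) := fun j => (hT (v j)).lintegral_prod_right'
  -- Each `Q i` at `x` is a combination of its averages at correlations `v j`, with weights
  -- independent of `i`; every average is dominated by that of `M`, so the supremum over `i` costs
  -- nothing.
  have hpt : ∀ x, M x ≤ ∑ j ∈ Finset.range (d + 1), ENNReal.ofReal |c j| * S j x := by
    intro x
    refine iSup_le fun i => ?_
    obtain ⟨q, hqd, hq⟩ := exists_polynomial_integral_eval (hQ i) x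
    have h1 : MvPolynomial.eval x (Q i) = q.eval 1 := by
      rw [← hq 1 zero_le_one le_rfl]; simp
    rw [h1, hc q hqd]
    refine (enorm_sum_le _ _).trans (Finset.sum_le_sum fun j hj => ?_)
    obtain ⟨hv0, hvρ⟩ := hv j hj
    rw [enorm_mul, Real.enorm_eq_ofReal_abs, ← hq (v j) hv0 (hvρ.trans hρ1)]
    gcongr
    refine (enorm_integral_le_lintegral_enorm _).trans (lintegral_mono fun z => ?_)
    exact le_iSup (fun i => ‖MvPolynomial.eval (v j • x + √(1 - v j ^ 2) • z) (Q i)‖ₑ) i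
  have hSle : ∀ j ∈ Finset.range (d + 1),
      eLpNorm (S j) (ENNReal.ofReal r) γ ≤ eLpNorm M (ENNReal.ofReal p) γ := by
    intro j hj
    obtain ⟨hv0, hvρ⟩ := hv j hj
    rw [eLpNorm_ofReal_eq (by linarith), eLpNorm_ofReal_eq (by linarith)]
    have hv2 : v j ^ 2 ≤ ρ ^ 2 := by gcongr
    have hv1 : v j ^ 2 ≤ 1 := hv2.trans (by nlinarith)
    refine gaussian_hypercontractive hp hr ?_ (hv2.trans_eq hρsq) hMm
    rw [Real.sq_sqrt (by linarith)]; ring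
  have hr1 : (1 : ℝ≥0∞) ≤ ENNReal.ofReal r := by simpa using hr.le
  calc eLpNorm M (ENNReal.ofReal r) γ
      ≤ eLpNorm (∑ j ∈ Finset.range (d + 1), fun x => ENNReal.ofReal |c j| * S j x)
          (ENNReal.ofReal r) γ := by
        refine eLpNorm_mono_enorm fun x => ?_
        simpa using hpt x
    _ ≤ ∑ j ∈ Finset.range (d + 1), eLpNorm (fun x => ENNReal.ofReal |c j| * S j x)
          (ENNReal.ofReal r) γ :=
        eLpNorm_sum_le (fun j _ => ((hSm j).const_mul _).aestronglyMeasurable) hr1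
    _ ≤ ∑ j ∈ Finset.range (d + 1), ENNReal.ofReal |c j| * eLpNorm M (ENNReal.ofReal p) γ := by
        refine Finset.sum_le_sum fun j hj => ?_
        refine le_trans (le_of_eq ?_) (mul_le_mul_right (hSle j hj) _)
        have hr0 : 0 < r := by linarith
        rw [eLpNorm_ofReal_eq hr0, eLpNorm_ofReal_eq hr0]
        simp_rw [ENNReal.mul_rpow_of_nonneg _ _ hr0.le]
        rw [lintegral_const_mul _ ((hSm j).pow_const r), ENNReal.mul_rpow_of_nonneg _ _ (by positivity),
          ← ENNReal.rpow_mul, mul_one_div_cancel hr0.ne', ENNReal.rpow_one]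
    _ = ENNReal.ofReal (∑ j ∈ Finset.range (d + 1), |c j|) * eLpNorm M (ENNReal.ofReal p) γ := by
        rw [← Finset.sum_mul, ENNReal.ofReal_sum_of_nonneg fun _ _ => abs_nonneg _]
    _ ≤ _ := by
        gcongr
        refine hsum.trans_eq ?_
        rw [chaosConst]
        congr 1
        rw [hρdef, Real.sqrt_eq_rpow, ← Real.rpow_natCast, ← Real.rpow_mul hq0.le,
          ← Real.inv_rpow hq0.le, inv_div]
        congr 1; ring

/-! ### Stability of moment comparison under limits -/

/-- Comparability of all moments of order greater than one, with the chaos constant. -/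
def MomentComparison {Ω : Type*} [MeasurableSpace Ω] (P : Measure Ω) (d : ℕ) (M : Ω → ℝ≥0∞) :
    Prop :=
  ∀ p r : ℝ, 1 < p → p < r →
    eLpNorm M (ENNReal.ofReal r) P ≤
      ENNReal.ofReal (chaosConst d p r) * eLpNorm M (ENNReal.ofReal p) P ∧
    eLpNorm M (ENNReal.ofReal p) P < ∞

section MomentComparison

variable {Ω : Type*} [MeasurableSpace Ω] {P : Measure Ω} [IsProbabilityMeasure P] {d : ℕ}

/-- Paley–Zygmund: a small tail probability bounds the second moment. -/
lemma lintegral_sq_le_of_small_tail {M : Ω → ℝ≥0∞} (hM : AEMeasurable M P) {K L : ℝ≥0∞}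
    (hfin : ∫⁻ ω, M ω ^ (2 : ℝ) ∂P ≠ ∞)
    (h4 : (∫⁻ ω, M ω ^ (4 : ℝ) ∂P) ^ (1 / 2 : ℝ) ≤ K * ∫⁻ ω, M ω ^ (2 : ℝ) ∂P)
    (hK : K * (∫⁻ ω, min (M ω / L) 1 ∂P) ^ (1 / 2 : ℝ) ≤ 1 / 2) :
    ∫⁻ ω, M ω ^ (2 : ℝ) ∂P ≤ 2 * L ^ (2 : ℝ) := by
  set A := ∫⁻ ω, M ω ^ (2 : ℝ) ∂P with hA
  -- The square root of a continuous substitute for the indicator of `M > L`. Continuity lets the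
  -- tail condition pass from a limit to its approximants.
  let g : Ω → ℝ≥0∞ := fun ω => min (M ω / L) 1 ^ (1 / 2 : ℝ)
  have hg : AEMeasurable g P := ((hM.div_const L).min aemeasurable_const).pow_const _
  have hpt : ∀ ω, M ω ^ (2 : ℝ) ≤ L ^ (2 : ℝ) + M ω ^ (2 : ℝ) * g ω := by
    intro ω
    rcases le_or_gt (M ω) L with h | h
    · exact (ENNReal.rpow_le_rpow h (by norm_num)).trans le_self_add
    · have hg1 : g ω = 1 := by
        have h1 : 1 ≤ M ω / L := by
          rw [ENNReal.le_div_iff_mul_le (Or.inr (by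
            rintro h0; rw [h0] at h; exact not_lt_zero h)) (Or.inl h.ne_top)]
          rw [one_mul]; exact h.le
        simp only [g]
        rw [min_eq_right h1, ENNReal.one_rpow]
      rw [hg1, mul_one]
      exact le_add_self
  have h1 : A ≤ L ^ (2 : ℝ) + A * (1 / 2) := by
    calc A ≤ ∫⁻ ω, (L ^ (2 : ℝ) + M ω ^ (2 : ℝ) * g ω) ∂P := lintegral_mono hpt
      _ = L ^ (2 : ℝ) + ∫⁻ ω, M ω ^ (2 : ℝ) * g ω ∂P := by
          rw [lintegral_add_left measurable_const]; simp
      _ ≤ L ^ (2 : ℝ) + (∫⁻ ω, (M ω ^ (2 : ℝ)) ^ (2 : ℝ) ∂P) ^ (1 / 2 : ℝ) *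
            (∫⁻ ω, g ω ^ (2 : ℝ) ∂P) ^ (1 / 2 : ℝ) := by
          gcongr
          exact ENNReal.lintegral_mul_le_Lp_mul_Lq P
            (Real.holderConjugate_iff.2 ⟨by norm_num, by norm_num⟩) (hM.pow_const _) hg
      _ = L ^ (2 : ℝ) + (∫⁻ ω, M ω ^ (4 : ℝ) ∂P) ^ (1 / 2 : ℝ) *
            (∫⁻ ω, min (M ω / L) 1 ∂P) ^ (1 / 2 : ℝ) := by
          simp only [g, ← ENNReal.rpow_mul]
          norm_num
      _ ≤ L ^ (2 : ℝ) + K * A * (∫⁻ ω, min (M ω / L) 1 ∂P) ^ (1 / 2 : ℝ) := by gcongr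
      _ = L ^ (2 : ℝ) + A * (K * (∫⁻ ω, min (M ω / L) 1 ∂P) ^ (1 / 2 : ℝ)) := by ring
      _ ≤ _ := by gcongr
  rw [one_div, ← div_eq_mul_inv] at h1
  have h2 : A / 2 + A / 2 ≤ L ^ (2 : ℝ) + A / 2 := by rwa [ENNReal.add_halves]
  have h3 : A / 2 ≤ L ^ (2 : ℝ) :=
    (ENNReal.add_le_add_iff_right (ENNReal.div_ne_top hfin (by norm_num))).1 h2
  calc A = 2 * (A / 2) := (ENNReal.mul_div_cancel (by norm_num) (by norm_num)).symm
    _ ≤ _ := by gcongr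

lemma tendsto_lintegral_comp_of_le_const {Mk : ℕ → Ω → ℝ≥0∞} {M : Ω → ℝ≥0∞}
    (hM : ∀ k, AEMeasurable (Mk k) P) (hlim : ∀ᵐ ω ∂P, Tendsto (fun k => Mk k ω) atTop (𝓝 (M ω)))
    {φ : ℝ≥0∞ → ℝ≥0∞} (hφ : Continuous φ) {c : ℝ≥0∞} (hc : c ≠ ∞) (hφc : ∀ x, φ x ≤ c) :
    Tendsto (fun k => ∫⁻ ω, φ (Mk k ω) ∂P) atTop (𝓝 (∫⁻ ω, φ (M ω) ∂P)) :=
  tendsto_lintegral_of_dominated_convergence' (fun _ => c)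
    (fun k => hφ.measurable.comp_aemeasurable (hM k)) (fun _ => ae_of_all _ fun _ => hφc _)
    (by simpa using hc) (hlim.mono fun _ hω => (hφ.tendsto _).comp hω)

lemma exists_truncation_level {M : Ω → ℝ≥0∞} (hM : AEMeasurable M P) (hfin : ∀ᵐ ω ∂P, M ω < ∞)
    {δ : ℝ≥0∞} (hδ : 0 < δ) : ∃ L : ℕ, 0 < L ∧ ∫⁻ ω, min (M ω / L) 1 ∂P < δ := by
  have h : Tendsto (fun n : ℕ => ∫⁻ ω, min (M ω / n) 1 ∂P) atTop (𝓝 (∫⁻ _, 0 ∂P)) := by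
    refine tendsto_lintegral_of_dominated_convergence' (fun _ => 1)
      (fun k => (hM.div_const _).min aemeasurable_const)
      (fun _ => ae_of_all _ fun _ => min_le_right _ _) (by simp) ?_
    filter_upwards [hfin] with ω hω
    have h1 : Tendsto (fun n : ℕ => M ω / (n : ℝ≥0∞)) atTop (𝓝 (M ω / ∞)) :=
      ENNReal.Tendsto.const_div ENNReal.tendsto_nat_nhds_top (Or.inr hω.ne)
    rw [ENNReal.div_top] at h1
    simpa using h1.min (tendsto_const_nhds (x := (1 : ℝ≥0∞)))
  rw [lintegral_zero] at h
  obtain ⟨L, h1, h2⟩ := ((h.eventually_lt_const hδ).and (eventually_gt_atTop 0)).exists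
  exact ⟨L, h2, h1⟩

/-- `M ^ p` is controlled by its truncation and a higher moment. -/
lemma rpow_le_min_rpow_add {p s : ℝ} (hp : 0 < p) (hps : p < s) (x : ℝ≥0∞) {L : ℝ≥0∞}
    (hL0 : L ≠ 0) (hLt : L ≠ ∞) : x ^ p ≤ min x L ^ p + (L⁻¹) ^ (s - p) * x ^ s := by
  rcases le_or_gt x L with h | h
  · rw [min_eq_left h]; exact le_self_add
  · refine le_trans ?_ le_add_self
    have hx0 : x ≠ 0 := (zero_le.trans_lt h).ne'
    rcases eq_or_ne x ∞ with rfl | hxt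
    · rw [ENNReal.top_rpow_of_pos (hp.trans hps), ENNReal.mul_top]
      · exact le_top
      · simp [ENNReal.rpow_eq_zero_iff, hLt, hps.le]
    · calc x ^ p = x ^ p * ((L⁻¹) ^ (s - p) * L ^ (s - p)) := by
            rw [← ENNReal.mul_rpow_of_nonneg _ _ (by linarith), ENNReal.inv_mul_cancel hL0 hLt,
              ENNReal.one_rpow, mul_one]
        _ ≤ x ^ p * ((L⁻¹) ^ (s - p) * x ^ (s - p)) := by
            gcongr
        _ = (L⁻¹) ^ (s - p) * (x ^ (s - p) * x ^ p) := by ring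
        _ = _ := by rw [← ENNReal.rpow_add _ _ hx0 hxt, sub_add_cancel]

/-- Comparability of moments is stable under almost sure convergence to a finite limit. -/
theorem MomentComparison.of_tendsto_ae {Mk : ℕ → Ω → ℝ≥0∞} {M : Ω → ℝ≥0∞}
    (hMk : ∀ k, AEMeasurable (Mk k) P) (hcomp : ∀ k, MomentComparison P d (Mk k))
    (hlim : ∀ᵐ ω ∂P, Tendsto (fun k => Mk k ω) atTop (𝓝 (M ω))) (hfin : ∀ᵐ ω ∂P, M ω < ∞) :
    MomentComparison P d M := by
  have hM : AEMeasurable M P := aemeasurable_of_tendsto_metrizable_ae atTop hMk hlim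
  -- a uniform bound on second moments
  set C := ENNReal.ofReal (chaosConst d 2 4)
  have h4 : ∀ k, (∫⁻ ω, Mk k ω ^ (4 : ℝ) ∂P) ^ (1 / 2 : ℝ) ≤
      C ^ (2 : ℝ) * ∫⁻ ω, Mk k ω ^ (2 : ℝ) ∂P := by
    intro k
    have h := (hcomp k 2 4 (by norm_num) (by norm_num)).1
    rw [eLpNorm_ofReal_eq (by norm_num), eLpNorm_ofReal_eq (by norm_num)] at h
    have h' := ENNReal.rpow_le_rpow h (by norm_num : (0 : ℝ) ≤ 2)
    rw [ENNReal.mul_rpow_of_nonneg _ _ (by norm_num), ← ENNReal.rpow_mul, ← ENNReal.rpow_mul] at h'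
    norm_num at h' ⊢
    exact h'
  have h2 : ∀ k, ∫⁻ ω, Mk k ω ^ (2 : ℝ) ∂P ≠ ∞ := by
    intro k h
    have := (hcomp k 2 4 (by norm_num) (by norm_num)).2
    rw [eLpNorm_ofReal_eq (by norm_num), h, ENNReal.top_rpow_of_pos (by norm_num)] at this
    exact this.ne rfl
  have hKt : C ^ (2 : ℝ) ≠ ∞ := ENNReal.rpow_ne_top_of_nonneg (by norm_num) ENNReal.ofReal_ne_top
  -- The tail threshold depends only on the comparison constant between orders `2` and `4`, not on
  -- `k`.
  obtain ⟨δ, hδ, hδK⟩ : ∃ δ : ℝ≥0∞, 0 < δ ∧ ∀ x, x < δ → C ^ (2 : ℝ) * x ^ (1 / 2 : ℝ) ≤ 1 / 2 := by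
    have ht : Tendsto (fun x : ℝ≥0∞ => C ^ (2 : ℝ) * x ^ (1 / 2 : ℝ)) (𝓝 0) (𝓝 0) := by
      have h0 : Tendsto (fun x : ℝ≥0∞ => x ^ (1 / 2 : ℝ)) (𝓝 0) (𝓝 (0 ^ (1 / 2 : ℝ))) :=
        (ENNReal.continuous_rpow_const).tendsto 0
      rw [ENNReal.zero_rpow_of_pos (by norm_num)] at h0
      simpa using ENNReal.Tendsto.const_mul h0 (Or.inr hKt)
    have := ht.eventually_lt_const (show (0 : ℝ≥0∞) < 1 / 2 by norm_num)
    obtain ⟨δ, hδ, h⟩ := ENNReal.nhds_zero_basis.eventually_iff.1 this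
    exact ⟨δ, hδ, fun x hx => (h hx).le⟩
  obtain ⟨L, hL0, hL⟩ := exists_truncation_level hM hfin hδ
  -- Finiteness of the limit makes its truncated tail smaller than `δ`; eventually the same holds
  -- for `Mk k`, and the Paley–Zygmund bound applies.
  have hev : ∀ᶠ k in atTop, ∫⁻ ω, Mk k ω ^ (2 : ℝ) ∂P ≤ 2 * (L : ℝ≥0∞) ^ (2 : ℝ) := by
    have hcont : Continuous fun x : ℝ≥0∞ => min (x / L) 1 :=
      (ENNReal.continuous_div_const _ (by exact_mod_cast hL0.ne')).min continuous_const
    have := (tendsto_lintegral_comp_of_le_const hMk hlim hcont ENNReal.one_ne_top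
      (fun x => min_le_right _ _)).eventually_lt_const hL
    filter_upwards [this] with k hk
    exact lintegral_sq_le_of_small_tail (hMk k) (h2 k) (h4 k) (hδK _ hk)
  -- uniform bounds on all moments
  have hbound : ∀ s : ℝ, 2 < s → ∃ B : ℝ≥0∞, B ≠ ∞ ∧ ∀ᶠ k in atTop, ∫⁻ ω, Mk k ω ^ s ∂P ≤ B := by
    intro s hs
    refine ⟨(ENNReal.ofReal (chaosConst d 2 s) * (2 * (L : ℝ≥0∞) ^ (2 : ℝ)) ^ (1 / 2 : ℝ)) ^ s, ?_, ?_⟩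
    · refine ENNReal.rpow_ne_top_of_nonneg (by linarith) (ENNReal.mul_ne_top ENNReal.ofReal_ne_top ?_)
      refine ENNReal.rpow_ne_top_of_nonneg (by norm_num) (ENNReal.mul_ne_top (by norm_num) ?_)
      exact ENNReal.rpow_ne_top_of_nonneg (by norm_num) (ENNReal.natCast_ne_top L)
    · filter_upwards [hev] with k hk
      have h := (hcomp k 2 s (by norm_num) hs).1
      rw [eLpNorm_ofReal_eq (by linarith), eLpNorm_ofReal_eq (by norm_num)] at h
      calc _ = ((∫⁻ ω, Mk k ω ^ s ∂P) ^ (1 / s)) ^ s := by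
            rw [← ENNReal.rpow_mul, one_div_mul_cancel (by linarith), ENNReal.rpow_one]
        _ ≤ _ := by
            refine ENNReal.rpow_le_rpow (h.trans ?_) (by linarith)
            gcongr
  have hfatou : ∀ s : ℝ, 0 < s → ∀ B : ℝ≥0∞, (∀ᶠ k in atTop, ∫⁻ ω, Mk k ω ^ s ∂P ≤ B) →
      ∫⁻ ω, M ω ^ s ∂P ≤ B := by
    intro s hs B hB
    calc _ = ∫⁻ ω, liminf (fun k => Mk k ω ^ s) atTop ∂P :=
          lintegral_congr_ae (hlim.mono fun ω hω => ((hω.ennrpow_const s).liminf_eq).symm)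
      _ ≤ liminf (fun k => ∫⁻ ω, Mk k ω ^ s ∂P) atTop :=
          lintegral_liminf_le' fun k => (hMk k).pow_const s
      _ ≤ liminf (fun _ : ℕ => B) atTop := liminf_le_liminf hB
      _ = B := liminf_const B
  have hMfin : ∀ p : ℝ, 0 < p → ∫⁻ ω, M ω ^ p ∂P ≠ ∞ := by
    intro p hp
    obtain ⟨B, hB, hBk⟩ := hbound (max p 2 + 1) (by linarith [le_max_right p 2])
    have hMs := hfatou _ (by linarith [le_max_right p 2]) B hBk
    have hle : ∫⁻ ω, M ω ^ p ∂P ≤ ∫⁻ ω, (1 + 1 * M ω ^ (max p 2 + 1)) ∂P := by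
      refine lintegral_mono fun ω => ?_
      refine (rpow_le_min_rpow_add hp (by linarith [le_max_left p 2] : p < max p 2 + 1) (M ω)
        one_ne_zero ENNReal.one_ne_top).trans ?_
      simp only [inv_one, ENNReal.one_rpow]
      gcongr
      exact ENNReal.rpow_le_one (min_le_right _ _) hp.le
    refine ne_top_of_le_ne_top ?_ hle
    rw [lintegral_add_left measurable_const]
    simp only [one_mul, lintegral_const, measure_univ]
    exact ENNReal.add_ne_top.2 ⟨ENNReal.one_ne_top, ne_top_of_le_ne_top hB hMs⟩
  -- upper semicontinuity of moments
  have husc : ∀ p : ℝ, 1 < p → ∀ η : ℝ≥0∞, 0 < η → η ≠ ∞ →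
      ∀ᶠ k in atTop, ∫⁻ ω, Mk k ω ^ p ∂P ≤ (∫⁻ ω, M ω ^ p ∂P) + η := by
    intro p hp η hη hηt
    have hp0 : 0 < p := by linarith
    set s := max p 2 + 1
    have hps : p < s := by linarith [le_max_left p 2]
    obtain ⟨B, hB, hBk⟩ := hbound s (by linarith [le_max_right p 2])
    have hη2 : 0 < η / 2 := ENNReal.half_pos hη.ne'
    obtain ⟨N, hN0, hN⟩ : ∃ N : ℕ, 0 < N ∧ ((N : ℝ≥0∞)⁻¹) ^ (s - p) * B < η / 2 := by
      have h0 : Tendsto (fun N : ℕ => ((N : ℝ≥0∞)⁻¹) ^ (s - p) * B) atTop (𝓝 0) := by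
        have h1 := (ENNReal.tendsto_inv_nat_nhds_zero).ennrpow_const (s - p)
        rw [ENNReal.zero_rpow_of_pos (by linarith)] at h1
        simpa using ENNReal.Tendsto.mul_const h1 (Or.inr hB)
      obtain ⟨N, h1, h2⟩ := ((h0.eventually_lt_const hη2).and (eventually_gt_atTop 0)).exists
      exact ⟨N, h2, h1⟩
    have hcont : Continuous fun x : ℝ≥0∞ => min x N ^ p :=
      ENNReal.continuous_rpow_const.comp (continuous_id.min continuous_const)
    have htr := tendsto_lintegral_comp_of_le_const hMk hlim hcont
      (c := (N : ℝ≥0∞) ^ p) (by simp [hp0.le])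
      (fun x => ENNReal.rpow_le_rpow (min_le_right _ _) hp0.le)
    have hlt : ∫⁻ ω, min (M ω) N ^ p ∂P < (∫⁻ ω, M ω ^ p ∂P) + η / 2 := by
      refine lt_of_le_of_lt ?_ (ENNReal.lt_add_right (hMfin p hp0) hη2.ne')
      exact lintegral_mono fun ω => ENNReal.rpow_le_rpow (min_le_left _ _) hp0.le
    filter_upwards [htr.eventually_lt_const hlt, hBk] with k hk hBk'
    calc _ ≤ ∫⁻ ω, (min (Mk k ω) N ^ p + ((N : ℝ≥0∞)⁻¹) ^ (s - p) * Mk k ω ^ s) ∂P :=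
          lintegral_mono fun ω => rpow_le_min_rpow_add hp0 hps _ (by exact_mod_cast hN0.ne')
            (ENNReal.natCast_ne_top N)
      _ = ∫⁻ ω, min (Mk k ω) N ^ p ∂P + ((N : ℝ≥0∞)⁻¹) ^ (s - p) * ∫⁻ ω, Mk k ω ^ s ∂P := by
          rw [lintegral_add_left' (((hMk k).min aemeasurable_const).pow_const p),
            lintegral_const_mul'' _ ((hMk k).pow_const s)]
      _ ≤ ((∫⁻ ω, M ω ^ p ∂P) + η / 2) + η / 2 := by
          refine add_le_add hk.le (le_trans ?_ hN.le)
          gcongr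
      _ = _ := by rw [add_assoc, ENNReal.add_halves]
  intro p r hp hpr
  have hp0 : 0 < p := by linarith
  have hr0 : 0 < r := by linarith
  rw [eLpNorm_ofReal_eq hr0, eLpNorm_ofReal_eq hp0]
  refine ⟨?_, ENNReal.rpow_lt_top_of_nonneg (by positivity) (hMfin p hp0)⟩
  set D := ENNReal.ofReal (chaosConst d p r)
  -- Fatou bounds the moment of order `r` from the approximants, whose moments of order `p`
  -- eventually exceed that of `M` by at most any prescribed slack, here `1 / (n + 1)`.
  have hη : ∀ n : ℕ, (∫⁻ ω, M ω ^ r ∂P) ^ (1 / r) ≤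
      D * ((∫⁻ ω, M ω ^ p ∂P) + ((n : ℝ≥0∞) + 1)⁻¹) ^ (1 / p) := by
    intro n
    set U := D * ((∫⁻ ω, M ω ^ p ∂P) + ((n : ℝ≥0∞) + 1)⁻¹) ^ (1 / p)
    have h := hfatou r hr0 (U ^ r) (by
      filter_upwards [husc p hp ((n : ℝ≥0∞) + 1)⁻¹ (by simp) (by simp)] with k hk
      have h := (hcomp k p r hp hpr).1
      rw [eLpNorm_ofReal_eq hr0, eLpNorm_ofReal_eq hp0] at h
      calc _ = ((∫⁻ ω, Mk k ω ^ r ∂P) ^ (1 / r)) ^ r := by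
            rw [← ENNReal.rpow_mul, one_div_mul_cancel hr0.ne', ENNReal.rpow_one]
        _ ≤ _ := by
            refine ENNReal.rpow_le_rpow (h.trans ?_) hr0.le
            exact mul_le_mul_right (ENNReal.rpow_le_rpow hk (by positivity)) D)
    calc _ ≤ (U ^ r) ^ (1 / r) := by gcongr
      _ = U := by rw [← ENNReal.rpow_mul, mul_one_div_cancel hr0.ne', ENNReal.rpow_one]
  have h1 : Tendsto (fun n : ℕ => ((n : ℝ≥0∞) + 1)⁻¹) atTop (𝓝 0) := by
    have := (tendsto_add_atTop_iff_nat 1).2 ENNReal.tendsto_inv_nat_nhds_zero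
    simpa using this
  have h2 := ((tendsto_const_nhds (x := ∫⁻ ω, M ω ^ p ∂P)).add h1).ennrpow_const (1 / p)
  rw [add_zero] at h2
  exact ge_of_tendsto' (ENNReal.Tendsto.const_mul h2 (Or.inr ENNReal.ofReal_ne_top)) hη

end MomentComparison

/-! ### From Gaussian spaces to independent standard variables, and to the chaos -/

open scoped MatrixOrder in
/-- A finite family in a Gaussian space is, in law, an affine image of independent standard
Gaussian variables. -/
lemma IsGaussianSpace.exists_map_eq {Ω : Type*} [MeasurableSpace Ω] {P : Measure Ω}
    [IsProbabilityMeasure P] {𝒢 : Submodule ℝ (Ω → ℝ)} (h𝒢 : IsGaussianSpace P 𝒢) {n : ℕ}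
    (Z : Fin n → Ω → ℝ) (hZ : ∀ i, Z i ∈ 𝒢) :
    ∃ (m : Fin n → ℝ) (B : Matrix (Fin n) (Fin n) ℝ),
      P.map (fun ω i => Z i ω) =
        (Measure.pi fun _ : Fin n => gaussianReal 0 1).map (fun x => m + B.mulVec x) := by
  have hZm : ∀ i, AEMeasurable (Z i) P := fun i => (h𝒢 _ (hZ i)).aemeasurable
  have hL2 : ∀ i, MemLp (Z i) 2 P := fun i => (h𝒢 _ (hZ i)).memLp_two
  let V : Ω → EuclideanSpace ℝ (Fin n) := fun ω => WithLp.toLp 2 (Z · ω)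
  have hV : AEMeasurable V P := by fun_prop
  have hg : IsGaussian (P.map V) := by
    constructor
    intro L
    -- Every linear functional of the vector is a linear combination of the `Z i`, hence lies in the
    -- vector space `𝒢` and is Gaussian. So the joint law is Gaussian.
    have h1 : L ∘ V ∈ 𝒢 := by
      have : L ∘ V = ∑ i, L (EuclideanSpace.basisFun (Fin n) ℝ i) • Z i := by
        ext ω
        simp only [Function.comp, Finset.sum_apply, Pi.smul_apply, smul_eq_mul]
        conv_lhs => rw [← (EuclideanSpace.basisFun (Fin n) ℝ).sum_repr (V ω)]
        rw [map_sum]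
        refine Finset.sum_congr rfl fun i _ => ?_
        rw [map_smul, smul_eq_mul, mul_comm]
        simp [V]
      rw [this]
      exact Submodule.sum_mem _ fun i _ => Submodule.smul_mem _ _ (hZ i)
    have h2 := (h𝒢 _ h1).map_eq_gaussianReal
    rw [AEMeasurable.map_map_of_aemeasurable (by fun_prop) hV, h2, integral_map hV (by fun_prop),
      variance_map (by fun_prop) hV]
    rfl
  let S : Matrix (Fin n) (Fin n) ℝ := Matrix.of fun i j => cov[Z i, Z j; P]
  have hS : ∀ x y : EuclideanSpace ℝ (Fin n),
      covarianceBilin (P.map V) x y = x.ofLp ⬝ᵥ S.mulVec y.ofLp := by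
    intro x y
    refine (covarianceBilin_apply_pi hL2 x y).trans ?_
    simp only [dotProduct, Matrix.mulVec, S, Matrix.of_apply, Finset.mul_sum]
    refine Finset.sum_congr rfl fun i _ => Finset.sum_congr rfl fun j _ => by ring
  have hpos : S.PosSemidef := by
    refine Matrix.PosSemidef.of_dotProduct_mulVec_nonneg ?_ fun x => ?_
    · ext i j
      simp [S, covariance_comm]
    · have := covarianceBilin_self_nonneg (μ := P.map V) (WithLp.toLp 2 x)
      rw [hS] at this
      simpa using this
  set m := (P.map V)[id]
  have hlaw : P.map V = multivariateGaussian m S := by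
    refine IsGaussian.ext ?_ ?_
    · rw [integral_id_multivariateGaussian']
    · ext x y
      rw [hS, covarianceBilin_multivariateGaussian hpos]
  -- The positive semidefinite square root exists even for singular covariance, so degenerate
  -- variables need no separate treatment.
  let B := CFC.sqrt S
  refine ⟨m.ofLp, B, ?_⟩
  have h1 : P.map (fun ω i => Z i ω) = (P.map V).map WithLp.ofLp := by
    rw [AEMeasurable.map_map_of_aemeasurable (by fun_prop) hV]
    rfl
  rw [h1, hlaw, multivariateGaussian, ← map_pi_eq_stdGaussian, Measure.map_map (by fun_prop) (by fun_prop),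
    Measure.map_map (by fun_prop) (by fun_prop)]
  congr 1

/-- Substituting polynomials of degree at most one does not raise the total degree. This also
absorbs the means of noncentred variables. -/
lemma exists_mvPolynomial_comp_affine {n d : ℕ} {Q : MvPolynomial (Fin n) ℝ}
    (hQ : Q.totalDegree ≤ d) (m : Fin n → ℝ) (B : Matrix (Fin n) (Fin n) ℝ) :
    ∃ R : MvPolynomial (Fin n) ℝ, R.totalDegree ≤ d ∧
      ∀ x, MvPolynomial.eval x R = MvPolynomial.eval (m + B.mulVec x) Q := by
  let A : Fin n → MvPolynomial (Fin n) ℝ := fun i =>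
    MvPolynomial.C (m i) + ∑ j, MvPolynomial.C (B i j) * MvPolynomial.X j
  have hA : ∀ i, (A i).totalDegree ≤ 1 := fun i => by
    refine (MvPolynomial.totalDegree_add _ _).trans (max_le (by simp) ?_)
    refine MvPolynomial.totalDegree_finsetSum_le fun j _ => ?_
    refine (MvPolynomial.totalDegree_mul _ _).trans ?_
    simp
  have hAe : ∀ i x, MvPolynomial.eval x (A i) = m i + B.mulVec x i := fun i x => by
    simp [A, Matrix.mulVec, dotProduct]
  refine ⟨∑ k ∈ Q.support, MvPolynomial.C (Q.coeff k) * ∏ i, A i ^ k i, ?_, fun x => ?_⟩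
  · refine MvPolynomial.totalDegree_finsetSum_le fun k hk => ?_
    refine (MvPolynomial.totalDegree_mul _ _).trans ?_
    rw [MvPolynomial.totalDegree_C, zero_add]
    refine (MvPolynomial.totalDegree_finsetProd _ _).trans ?_
    refine le_trans (Finset.sum_le_sum (g := fun i => k i) fun i _ => ?_) ?_
    · refine (MvPolynomial.totalDegree_pow _ _).trans ?_
      simpa using Nat.mul_le_mul_left (k i) (hA i)
    · refine le_trans (le_of_eq ?_) ((MvPolynomial.le_totalDegree hk).trans hQ)
      rw [Finsupp.sum_fintype _ _ (fun _ => rfl)]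
  · rw [MvPolynomial.eval_eq' (m + B.mulVec x) Q, map_sum]
    refine Finset.sum_congr rfl fun k _ => ?_
    rw [map_mul, MvPolynomial.eval_C, map_prod]
    congr 1
    refine Finset.prod_congr rfl fun i _ => ?_
    rw [map_pow, hAe]
    rfl

lemma lintegral_iSup_eval_rpow_ne_top {n : ℕ} {ι : Type*} [Finite ι]
    (Q : ι → MvPolynomial (Fin n) ℝ) {p : ℝ} (hp : 0 < p) :
    ∫⁻ x, (⨆ i, ‖MvPolynomial.eval x (Q i)‖ₑ) ^ p
      ∂(Measure.pi fun _ : Fin n => gaussianReal 0 1) ≠ ∞ := by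
  have := Fintype.ofFinite ι
  set γ := Measure.pi fun _ : Fin n => gaussianReal 0 1
  obtain ⟨k, hk⟩ := exists_nat_gt p
  have hpow : ∀ y : ℝ, ‖y‖ₑ ^ p ≤ 1 + ‖y ^ (2 * k)‖ₑ := fun y => by
    rw [enorm_pow, ← ENNReal.rpow_natCast]
    rcases le_total ‖y‖ₑ 1 with h | h
    · exact (ENNReal.rpow_le_one h hp.le).trans le_self_add
    · refine (ENNReal.rpow_le_rpow_of_exponent_le h ?_).trans le_add_self
      push_cast
      linarith
  have hle : ∀ x, (⨆ i, ‖MvPolynomial.eval x (Q i)‖ₑ) ^ p ≤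
      ∑ i, (1 + ‖MvPolynomial.eval x (Q i ^ (2 * k))‖ₑ) := fun x => by
    have hsum : ∀ i, ‖MvPolynomial.eval x (Q i)‖ₑ ^ p ≤
        ∑ i, (1 + ‖MvPolynomial.eval x (Q i ^ (2 * k))‖ₑ) := fun i => by
      refine (hpow _).trans ?_
      rw [← map_pow]
      exact Finset.single_le_sum (f := fun i => 1 + ‖MvPolynomial.eval x (Q i ^ (2 * k))‖ₑ)
        (fun _ _ => zero_le) (Finset.mem_univ i)
    calc _ ≤ ((∑ i, (1 + ‖MvPolynomial.eval x (Q i ^ (2 * k))‖ₑ)) ^ (1 / p)) ^ p := by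
          refine ENNReal.rpow_le_rpow (iSup_le fun i => ?_) hp.le
          refine le_trans (le_of_eq ?_) (ENNReal.rpow_le_rpow (hsum i) (by positivity : 0 ≤ 1 / p))
          rw [← ENNReal.rpow_mul, mul_one_div_cancel hp.ne', ENNReal.rpow_one]
      _ = _ := by rw [← ENNReal.rpow_mul, one_div_mul_cancel hp.ne', ENNReal.rpow_one]
  refine ne_top_of_le_ne_top ?_ (lintegral_mono hle)
  have hm : ∀ R : MvPolynomial (Fin n) ℝ, Measurable fun x => ‖MvPolynomial.eval x R‖ₑ :=
    fun R => (MvPolynomial.continuous_eval R).measurable.enorm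
  rw [lintegral_finsetSum _ fun i _ => (hm _).const_add 1]
  refine (ENNReal.sum_lt_top.2 fun i _ => ?_).ne
  rw [lintegral_add_left measurable_const]
  refine ENNReal.add_lt_top.2 ⟨by simp, ?_⟩
  have := (integrable_eval_affine (Q i ^ (2 * k)) 0 0 1).hasFiniteIntegral
  simp only [smul_zero, one_smul, zero_add] at this
  exact hasFiniteIntegral_iff_enorm.1 this

/-- Moment comparison for finite suprema of Gaussian polynomials. -/
theorem momentComparison_iSup_polynomials {Ω : Type*} [MeasurableSpace Ω] {P : Measure Ω}
    [IsProbabilityMeasure P] {𝒢 : Submodule ℝ (Ω → ℝ)} (h𝒢 : IsGaussianSpace P 𝒢) {d : ℕ}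
    {ι : Type*} [Finite ι] {Y : ι → Ω → ℝ} (hY : ∀ i, Y i ∈ gaussianPolynomials 𝒢 d) :
    AEMeasurable (fun ω => ⨆ i, ‖Y i ω‖ₑ) P ∧ MomentComparison P d (fun ω => ⨆ i, ‖Y i ω‖ₑ) := by
  have := Fintype.ofFinite ι
  choose n Z Q hZ hQ hYeq using hY
  -- All variables occurring in the finitely many polynomials are gathered into one tuple, so that a
  -- single joint law represents the whole family.
  let e := Fintype.equivFin (Σ i, Fin (n i))
  let Z' : Fin (Fintype.card (Σ i, Fin (n i))) → Ω → ℝ := fun k => Z (e.symm k).1 (e.symm k).2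
  have hZ' : ∀ k, Z' k ∈ 𝒢 := fun k => hZ _ _
  let Q' : ι → MvPolynomial (Fin (Fintype.card (Σ i, Fin (n i)))) ℝ := fun i =>
    MvPolynomial.rename (fun j => e ⟨i, j⟩) (Q i)
  have hQ' : ∀ i, (Q' i).totalDegree ≤ d := fun i =>
    (MvPolynomial.totalDegree_rename_le _ _).trans (hQ i)
  have hYQ : ∀ i ω, Y i ω = MvPolynomial.eval (fun k => Z' k ω) (Q' i) := fun i ω => by
    rw [hYeq i, MvPolynomial.eval_rename]
    have : (fun k => Z' k ω) ∘ (fun j => e ⟨i, j⟩) = fun j => Z i j ω := by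
      ext j
      simp only [Function.comp, Z']
      rw [Equiv.symm_apply_apply]
    rw [this]
  obtain ⟨m, B, hlaw⟩ := h𝒢.exists_map_eq Z' hZ'
  choose R hRd hR using fun i => exists_mvPolynomial_comp_affine (hQ' i) m B
  have hZm : AEMeasurable (fun ω k => Z' k ω) P :=
    aemeasurable_pi_lambda _ fun k => (h𝒢 _ (hZ' k)).aemeasurable
  let φ : (Fin (Fintype.card (Σ i, Fin (n i))) → ℝ) → ℝ≥0∞ := fun z =>
    ⨆ i, ‖MvPolynomial.eval z (Q' i)‖ₑ
  have hφ : Measurable φ :=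
    Measurable.iSup fun i => (MvPolynomial.continuous_eval (Q' i)).measurable.enorm
  have hYφ : (fun ω => ⨆ i, ‖Y i ω‖ₑ) = φ ∘ fun ω k => Z' k ω := by
    ext ω; simp [φ, hYQ]
  have hBm : Measurable fun x : Fin (Fintype.card (Σ i, Fin (n i))) → ℝ => m + B.mulVec x := by
    have : Continuous fun x : Fin (Fintype.card (Σ i, Fin (n i))) → ℝ => m + B.mulVec x :=
      continuous_const.add (Continuous.matrix_mulVec continuous_const continuous_id)
    exact this.measurable
  have hnorm : ∀ s : ℝ, 0 < s → eLpNorm (fun ω => ⨆ i, ‖Y i ω‖ₑ) (ENNReal.ofReal s) P =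
      eLpNorm (fun x => ⨆ i, ‖MvPolynomial.eval x (R i)‖ₑ) (ENNReal.ofReal s)
        (Measure.pi fun _ => gaussianReal 0 1) := fun s hs => by
    rw [hYφ, eLpNorm_ofReal_eq hs, eLpNorm_ofReal_eq hs]
    congr 1
    have h1 : ∫⁻ ω, (φ ∘ fun ω k => Z' k ω) ω ^ s ∂P = ∫⁻ z, φ z ^ s ∂(P.map fun ω k => Z' k ω) :=
      (lintegral_map' (hφ.pow_const s).aemeasurable hZm).symm
    rw [h1, hlaw, lintegral_map (hφ.pow_const s) hBm]
    simp only [φ, hR]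
  refine ⟨hYφ ▸ hφ.comp_aemeasurable hZm, fun p r hp hpr => ?_⟩
  rw [hnorm p (by linarith), hnorm r (by linarith)]
  refine ⟨eLpNorm_iSup_eval_le hRd hp hpr, ?_⟩
  rw [eLpNorm_ofReal_eq (by linarith)]
  exact ENNReal.rpow_lt_top_of_nonneg (by have : 0 < p := by linarith
                                          positivity)
    (lintegral_iSup_eval_rpow_ne_top R (by linarith))

/-- Moment comparison for countable suprema of elements of the Gaussian chaos. -/
theorem momentComparison_iSup_chaos {Ω : Type*} [MeasurableSpace Ω] {P : Measure Ω}
    [IsProbabilityMeasure P] {𝒢 : Submodule ℝ (Ω → ℝ)} (h𝒢 : IsGaussianSpace P 𝒢) {d : ℕ}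
    {Y : ℕ → Ω → ℝ} (hY : ∀ i, Y i ∈ gaussianChaos P 𝒢 d)
    (hfin : ∀ᵐ ω ∂P, ⨆ i, ‖Y i ω‖ₑ < ∞) :
    MomentComparison P d (fun ω => ⨆ i, ‖Y i ω‖ₑ) := by
  choose Q hQ hlim using hY
  choose ns hns hae using fun i => (hlim i).exists_seq_tendsto_ae
  have hall : ∀ᵐ ω ∂P, ∀ i, Tendsto (fun k => Q i (ns i k) ω) atTop (𝓝 (Y i ω)) :=
    ae_all_iff.2 hae
  let M : ℕ → Ω → ℝ≥0∞ := fun n ω => ⨆ i : Fin n, ‖Y i ω‖ₑ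
  let Mk : ℕ → ℕ → Ω → ℝ≥0∞ := fun n k ω => ⨆ i : Fin n, ‖Q i (ns i k) ω‖ₑ
  have hMk := fun n k => momentComparison_iSup_polynomials h𝒢 (d := d)
    (Y := fun i : Fin n => Q i (ns i k)) (fun i => hQ _ _)
  have hMklim : ∀ n, ∀ᵐ ω ∂P, Tendsto (fun k => Mk n k ω) atTop (𝓝 (M n ω)) := fun n => by
    filter_upwards [hall] with ω hω
    simp only [Mk, M, ← Finset.sup_univ_eq_iSup]
    exact Tendsto.finset_sup_nhds_apply fun i _ => (hω i).enorm
  have hMm : ∀ n, AEMeasurable (M n) P := fun n =>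
    aemeasurable_of_tendsto_metrizable_ae atTop (fun k => (hMk n k).1) (hMklim n)
  have hMfin : ∀ n ω, M n ω < ∞ := fun n ω => by
    simp only [M, ← Finset.sup_univ_eq_iSup]
    rw [Finset.sup_lt_iff ENNReal.zero_lt_top]
    exact fun i _ => enorm_lt_top
  -- For a fixed finite supremum, pass from polynomials to chaos elements along almost surely
  -- convergent subsequences. The number of functionals grows in a second limit, and only there is
  -- `hfin` needed.
  have hMc : ∀ n, MomentComparison P d (M n) := fun n =>
    MomentComparison.of_tendsto_ae (fun k => (hMk n k).1) (fun k => (hMk n k).2) (hMklim n)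
      (ae_of_all _ (hMfin n))
  refine MomentComparison.of_tendsto_ae hMm hMc (ae_of_all _ fun ω => ?_) hfin
  have hmono : Monotone fun n => M n ω := fun a b hab =>
    iSup_le fun i => le_iSup (fun i : Fin b => ‖Y i ω‖ₑ) (Fin.castLE hab i)
  have hsup : ⨆ n, M n ω = ⨆ i, ‖Y i ω‖ₑ := by
    refine le_antisymm (iSup_le fun n => iSup_le fun i => le_iSup (fun i => ‖Y i ω‖ₑ) (i : ℕ)) ?_
    refine iSup_le fun i => ?_
    exact (le_iSup (fun j : Fin (i + 1) => ‖Y j ω‖ₑ) (Fin.last i)).trans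
      (le_iSup (fun n => M n ω) (i + 1))
  rw [← hsup]
  exact tendsto_atTop_iSup hmono

/-! ### Lower semicontinuous pseudo-seminorms as countable suprema -/

section PseudoSeminorm

variable {F : Type*} [AddCommGroup F] [Module ℝ F] {N : F → ℝ≥0∞}

lemma IsPseudoSeminorm.map_zero (hN : IsPseudoSeminorm N) : N 0 = 0 := by
  simpa using hN.smul 0 0

lemma IsPseudoSeminorm.map_neg (hN : IsPseudoSeminorm N) (x : F) : N (-x) = N x := by
  simpa using hN.smul (-1) x

lemma IsPseudoSeminorm.convex_le_one (hN : IsPseudoSeminorm N) : Convex ℝ {x | N x ≤ 1} := by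
  intro x hx y hy a b ha hb hab
  simp only [Set.mem_ofPred_eq] at hx hy ⊢
  calc N (a • x + b • y) ≤ ENNReal.ofReal a * N x + ENNReal.ofReal b * N y := by
        simpa [hN.smul, abs_of_nonneg ha, abs_of_nonneg hb] using hN.add_le (a • x) (b • y)
    _ ≤ ENNReal.ofReal a * 1 + ENNReal.ofReal b * 1 := by gcongr
    _ = 1 := by rw [mul_one, mul_one, ← ENNReal.ofReal_add ha hb, hab, ENNReal.ofReal_one]

variable [TopologicalSpace F] [IsTopologicalAddGroup F] [ContinuousSMul ℝ F]
  [LocallyConvexSpace ℝ F]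

/-- A lower semicontinuous pseudo-seminorm is the supremum of the continuous linear functionals
that it dominates. -/
lemma IsPseudoSeminorm.exists_enorm_clm_gt (hN : IsPseudoSeminorm N)
    (hlsc : LowerSemicontinuous N) {t : ℝ} (ht : 0 < t) {x : F} (hx : ENNReal.ofReal t < N x) :
    ∃ φ : F →L[ℝ] ℝ, (∀ y, ‖φ y‖ₑ ≤ N y) ∧ ENNReal.ofReal t < ‖φ x‖ₑ := by
  have hclosed : IsClosed {y | N y ≤ 1} := hlsc.isClosed_preimage 1
  have hx' : t⁻¹ • x ∉ {y | N y ≤ 1} := by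
    rw [Set.mem_ofPred_eq, not_le, hN.smul, abs_of_pos (inv_pos.2 ht)]
    calc (1 : ℝ≥0∞) = ENNReal.ofReal t⁻¹ * ENNReal.ofReal t := by
          rw [← ENNReal.ofReal_mul (inv_pos.2 ht).le, inv_mul_cancel₀ ht.ne', ENNReal.ofReal_one]
      _ < _ := by
          refine (ENNReal.mul_lt_mul_iff_right ?_ ENNReal.ofReal_ne_top).2 hx
          simpa using ht
  -- The set `N ≤ 1` is convex and closed, so Hahn–Banach separates `t⁻¹ • x` from it. As it
  -- contains `0`, the level `u` is positive, and `u⁻¹ • f` is the required functional.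
  obtain ⟨f, u, hfu, hux⟩ := geometric_hahn_banach_closed_point hN.convex_le_one hclosed hx'
  have hu : 0 < u := by simpa using hfu 0 (by simp [hN.map_zero])
  have key : ∀ y, N y ≠ ∞ → f y ≤ u * (N y).toReal := fun y hy => by
    -- Normalising by any `c` above `N y` instead of by `N y` itself covers the case `N y = 0`.
    have h : ∀ c, (N y).toReal < c → f y / u ≤ c := fun c hc => by
      have hc0 : 0 < c := ENNReal.toReal_nonneg.trans_lt hc
      have h1 : N (c⁻¹ • y) ≤ 1 := by
        rw [hN.smul, abs_of_pos (inv_pos.2 hc0), ENNReal.ofReal_inv_of_pos hc0, mul_comm,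
          ← div_eq_mul_inv]
        exact ENNReal.div_le_of_le_mul
          (by rw [one_mul]; exact (ENNReal.le_ofReal_iff_toReal_le hy hc0.le).2 hc.le)
      have h2 := hfu _ h1
      rw [map_smul, smul_eq_mul, inv_mul_lt_iff₀ hc0] at h2
      rw [div_le_iff₀ hu]
      exact h2.le
    have := le_of_forall_gt_imp_ge_of_dense h
    rwa [div_le_iff₀' hu] at this
  refine ⟨u⁻¹ • f, fun y => ?_, ?_⟩
  · by_cases hy : N y = ∞
    · simp [hy]
    have h1 := key y hy
    have h2 := key (-y) (by rwa [hN.map_neg])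
    rw [hN.map_neg, _root_.map_neg] at h2
    rw [Real.enorm_eq_ofReal_abs, ENNReal.ofReal_le_iff_le_toReal hy]
    simp only [_root_.smul_apply, smul_eq_mul, abs_mul, abs_inv, abs_of_pos hu]
    rw [inv_mul_le_iff₀ hu]
    exact abs_le.2 ⟨by linarith, h1⟩
  · rw [Real.enorm_eq_ofReal_abs, ENNReal.ofReal_lt_ofReal_iff_of_nonneg ht.le]
    refine lt_of_lt_of_le ?_ (le_abs_self _)
    rw [map_smul, smul_eq_mul, lt_inv_mul_iff₀ ht] at hux
    simp only [_root_.smul_apply, smul_eq_mul]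
    rw [lt_inv_mul_iff₀ hu]
    linarith

/-- On a hereditarily Lindelöf set, a lower semicontinuous pseudo-seminorm is a countable supremum
of absolute values of continuous linear functionals. -/
lemma IsPseudoSeminorm.exists_seq_eq_iSup (hN : IsPseudoSeminorm N)
    (hlsc : LowerSemicontinuous N) {A : Set F} (hA : ∀ s ⊆ A, IsLindelof s) :
    ∃ φ : ℕ → F →L[ℝ] ℝ, ∀ x ∈ A, N x = ⨆ n, ‖φ n x‖ₑ := by
  -- For each positive rational level, the open sets where a dominated functional exceeds it cover
  -- the part of `A` where `N` does. Countable subcovers over all levels give a countable family.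
  have hcover : ∀ q : ℚ, 0 < q → ∃ T : Set {φ : F →L[ℝ] ℝ // ∀ y, ‖φ y‖ₑ ≤ N y}, T.Countable ∧
      {x ∈ A | ENNReal.ofReal q < N x} ⊆ ⋃ φ ∈ T, {x | ENNReal.ofReal q < ‖φ.1 x‖ₑ} := by
    intro q hq
    refine (hA _ (Set.sep_subset _ _)).elim_countable_subcover
      (fun φ : {φ : F →L[ℝ] ℝ // ∀ y, ‖φ y‖ₑ ≤ N y} => {x | ENNReal.ofReal q < ‖φ.1 x‖ₑ})
      (fun φ => isOpen_lt continuous_const φ.1.continuous.enorm) fun x hx => ?_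
    obtain ⟨φ, hφ, hlt⟩ := hN.exists_enorm_clm_gt hlsc (by exact_mod_cast hq) hx.2
    exact Set.mem_iUnion.2 ⟨⟨φ, hφ⟩, hlt⟩
  choose! T hTc hT using hcover
  -- The zero functional is added only to make the family nonempty, hence enumerable by `ℕ`.
  have hc : (insert ⟨0, by simp⟩ (⋃ q ∈ {q : ℚ | 0 < q}, T q)).Countable :=
    (Set.Countable.biUnion (Set.to_countable _) hTc).insert _
  obtain ⟨φ, hφ⟩ := hc.exists_eq_range (Set.insert_nonempty _ _)
  refine ⟨fun n => (φ n).1, fun x hx => le_antisymm ?_ (iSup_le fun n => (φ n).2 x)⟩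
  refine le_of_forall_lt fun a ha => ?_
  obtain ⟨q, hq0, haq, hqN⟩ := ENNReal.lt_iff_exists_rat_btwn.1 ha
  have hq : 0 < q := by
    refine lt_of_le_of_ne hq0 fun h => ?_
    simp [← h] at haq
  obtain ⟨ψ, hψ, hlt⟩ := Set.mem_iUnion₂.1 (hT q hq ⟨hx, hqN⟩)
  have hψ' : ψ ∈ Set.range φ := hφ ▸ Set.mem_insert_of_mem _ (Set.mem_biUnion hq hψ)
  obtain ⟨n, rfl⟩ := hψ'
  exact (haq.trans hlt).trans_le (le_iSup (fun n => ‖(φ n).1 x‖ₑ) n)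

end PseudoSeminorm

/-- In the metrizable case a separable subspace is second countable, hence hereditarily Lindelöf,
and this property is transported by the inclusion map. -/
lemma isLindelof_of_subset_separable {F : Type*} [TopologicalSpace F]
    (hF : MetrizableSpace F ∨ HereditarilyLindelofSpace F) {A : Set F} (hA : SeparableSpace A)
    {s : Set F} (hs : s ⊆ A) : IsLindelof s := by
  rcases hF with hF | hF
  · let _ := metrizableSpaceMetric F
    have : SecondCountableTopology A := UniformSpace.secondCountable_of_separable A
    have h := (HereditarilyLindelofSpace.isLindelof ((↑) ⁻¹' s : Set A)).image
      continuous_subtype_val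
    rwa [Subtype.image_preimage_coe, Set.inter_eq_right.2 hs] at h
  · exact HereditarilyLindelofSpace.isLindelof s

/-- Moment comparison for lower semicontinuous pseudo-seminorms of weak Gaussian chaoses. -/
theorem momentComparison_pseudoSeminorm {Ω : Type*} [MeasurableSpace Ω] {P : Measure Ω}
    [IsProbabilityMeasure P] {F : Type*} [AddCommGroup F] [Module ℝ F] [TopologicalSpace F]
    [IsTopologicalAddGroup F] [ContinuousSMul ℝ F] [LocallyConvexSpace ℝ F]
    (hF : MetrizableSpace F ∨ HereditarilyLindelofSpace F) {d : ℕ} {𝒢 : Submodule ℝ (Ω → ℝ)}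
    (h𝒢 : IsGaussianSpace P 𝒢) {X : Ω → F} (hsep : AESeparablyValued P X)
    (hweak : ∀ φ : F →L[ℝ] ℝ, (fun ω => φ (X ω)) ∈ gaussianChaos P 𝒢 d)
    {N : F → ℝ≥0∞} (hN : IsPseudoSeminorm N) (hlsc : LowerSemicontinuous N)
    (hfin : ∀ᵐ ω ∂P, N (X ω) < ∞) : MomentComparison P d (fun ω => N (X ω)) := by
  obtain ⟨A, -, hA, hXA⟩ := hsep
  obtain ⟨φ, hφ⟩ := hN.exists_seq_eq_iSup hlsc fun s hs => isLindelof_of_subset_separable hF hA hs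
  have hae : (fun ω => N (X ω)) =ᵐ[P] fun ω => ⨆ n, ‖φ n (X ω)‖ₑ := by
    filter_upwards [hXA] with ω hω using hφ _ hω
  have h := momentComparison_iSup_chaos h𝒢 (fun n => hweak (φ n)) (by
    filter_upwards [hae, hfin] with ω h1 h2
    rwa [← h1])
  intro p r hp hpr
  rw [eLpNorm_congr_ae hae, eLpNorm_congr_ae hae]
  exact h p r hp hpr

/-! ### Exponential integrability -/

/-- With `r = 2 k / d`, the power of `2` becomes `2 ^ ((d + 2) k)` and `(r - 1) ^ (d r / 2) ≤ (2 k /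
d) ^ k`; then `k ^ k / k! ≤ e ^ k`. The condition `d < k` means `r > 2`. The exponent `d + 3` would
suffice; `d + 5` is the weaker form used in the theorem. -/
lemma chaosConst_rpow_div_factorial_le {d k : ℕ} (hd : 1 ≤ d) (hk : d < k) :
    chaosConst d 2 (2 / d * k) ^ (2 / (d : ℝ) * k) / (k.factorial : ℝ) ≤
      (Real.exp 1 * 2 ^ (d + 5) / d) ^ k := by
  have hd0 : (0 : ℝ) < d := by exact_mod_cast hd
  have hkd : (d : ℝ) < k := by exact_mod_cast hk
  set r : ℝ := 2 / d * k
  have hr : 2 < r := by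
    have : r = 2 * (k / d) := by simp only [r]; ring
    rw [this]
    have := (one_lt_div hd0).2 hkd
    linarith
  have hC : chaosConst d 2 r ^ r ≤ (2 ^ (d + 3) / d) ^ k * (k : ℝ) ^ k := by
    have h1 : chaosConst d 2 r ≤ (2 : ℝ) ^ ((d : ℝ) ^ 2 / 2 + d) * r ^ ((d : ℝ) / 2) := by
      rw [chaosConst]
      gcongr
      · exact div_nonneg (by linarith) (by norm_num)
      · rw [div_le_iff₀ (by norm_num)]; linarith
    have h0 : 0 ≤ chaosConst d 2 r := by
      rw [chaosConst]
      exact mul_nonneg (by positivity)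
        (Real.rpow_nonneg (div_nonneg (by linarith) (by norm_num)) _)
    refine (Real.rpow_le_rpow h0 h1 (by linarith)).trans (le_of_eq ?_)
    have hr' : r = 2 / d * k := rfl
    conv_lhs => rw [Real.mul_rpow (by positivity) (by positivity)]
    rw [← Real.rpow_mul (by norm_num), ← Real.rpow_mul (by positivity)]
    have e1 : ((d : ℝ) ^ 2 / 2 + d) * r = ((d + 2 : ℕ) : ℝ) * k := by
      rw [hr']; push_cast; field_simp
    have e2 : (d : ℝ) / 2 * r = k := by
      rw [hr']; field_simp
    rw [e1, e2, Real.rpow_mul (by norm_num), Real.rpow_natCast, Real.rpow_natCast,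
      Real.rpow_natCast, ← mul_pow, ← mul_pow, hr']
    congr 1
    ring
  have hfac : (k : ℝ) ^ k / k.factorial ≤ Real.exp 1 ^ k := by
    rw [← Real.exp_nat_mul, mul_one]
    exact Real.pow_div_factorial_le_exp _ (Nat.cast_nonneg k) k
  calc chaosConst d 2 r ^ r / (k.factorial : ℝ)
      ≤ (2 ^ (d + 3) / d) ^ k * (k : ℝ) ^ k / k.factorial := by gcongr
    _ = (2 ^ (d + 3) / d) ^ k * ((k : ℝ) ^ k / k.factorial) := by ring
    _ ≤ (2 ^ (d + 3) / d) ^ k * Real.exp 1 ^ k := by gcongr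
    _ = (Real.exp 1 * 2 ^ (d + 3) / d) ^ k := by rw [← mul_pow]; congr 1; ring
    _ ≤ _ := by gcongr <;> norm_num

lemma ereal_exp_mul_eq_tsum {ε : ℝ} (hε : 0 ≤ ε) {y : ℝ≥0∞} (hy : y ≠ ∞) :
    EReal.exp ((ε : EReal) * (y : EReal)) =
      ∑' k : ℕ, ENNReal.ofReal ε ^ k / (k.factorial : ℝ≥0∞) * y ^ k := by
  lift y to NNReal using hy
  have hs := NormedSpace.expSeries_div_hasSum_exp (𝔸 := ℝ) (ε * y)
  rw [← Real.exp_eq_exp_ℝ] at hs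
  rw [EReal.coe_nnreal_eq_coe_real, ← EReal.coe_mul, EReal.exp_coe, ← hs.tsum_eq,
    ENNReal.ofReal_tsum_of_nonneg (fun k => by positivity) hs.summable]
  refine tsum_congr fun k => ?_
  rw [ENNReal.ofReal_div_of_pos (by positivity), mul_pow,
    ENNReal.ofReal_mul (by positivity), ENNReal.ofReal_pow hε, ENNReal.ofReal_pow y.coe_nonneg,
    ENNReal.ofReal_natCast, ENNReal.ofReal_coe_nnreal, div_eq_mul_inv, div_eq_mul_inv]
  ring

section Exponential

variable {Ω : Type*} [MeasurableSpace Ω] {P : Measure Ω} {d : ℕ} {M : Ω → ℝ≥0∞}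

lemma MomentComparison.lintegral_rpow_ne_top [IsProbabilityMeasure P]
    (h : MomentComparison P d M) {s : ℝ} (hs : 0 ≤ s) : ∫⁻ ω, M ω ^ s ∂P ≠ ∞ := by
  have h1 := (h (s + 2) (s + 3) (by linarith) (by linarith)).2
  rw [eLpNorm_ofReal_eq (by linarith)] at h1
  have h2 : ∫⁻ ω, M ω ^ (s + 2) ∂P ≠ ∞ := fun h3 => by
    rw [h3, ENNReal.top_rpow_of_pos (by positivity)] at h1
    exact h1.ne rfl
  refine ne_top_of_le_ne_top (b := ∫⁻ ω, (1 + M ω ^ (s + 2)) ∂P) ?_ (lintegral_mono fun ω => ?_)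
  · rw [lintegral_add_left measurable_const]
    exact ENNReal.add_ne_top.2 ⟨by simp, h2⟩
  · rcases le_total (M ω) 1 with h | h
    · exact (ENNReal.rpow_le_one h hs).trans le_self_add
    · exact (ENNReal.rpow_le_rpow_of_exponent_le h (by linarith)).trans le_add_self

lemma MomentComparison.lintegral_pow_le (h : MomentComparison P d M) (hd : 1 ≤ d) {k : ℕ}
    (hk : d < k) :
    (∫⁻ ω, M ω ^ (2 / (d : ℝ) * k) ∂P) / (k.factorial : ℝ≥0∞) ≤
      (ENNReal.ofReal (Real.exp 1) * 2 ^ (d + 5) * eLpNorm M 2 P ^ (2 / (d : ℝ)) / d) ^ k := by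
  have hd0 : (0 : ℝ) < d := by exact_mod_cast hd
  have hkd : (d : ℝ) < k := by exact_mod_cast hk
  have hr : 2 < 2 / (d : ℝ) * k := by
    have : 2 / (d : ℝ) * k = 2 * (k / d) := by ring
    rw [this]
    have := (one_lt_div hd0).2 hkd
    linarith
  have hreal := chaosConst_rpow_div_factorial_le hd hk
  have h1 := (h 2 _ (by norm_num) hr).1
  have h0 : 0 ≤ chaosConst d 2 (2 / d * k) := by
    rw [chaosConst]
    exact mul_nonneg (by positivity)
      (Real.rpow_nonneg (div_nonneg (by linarith) (by norm_num)) _)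
  rw [eLpNorm_ofReal_eq (by linarith), show ENNReal.ofReal 2 = 2 by simp] at h1
  set r : ℝ := 2 / (d : ℝ) * k with hrdef
  have h2 := ENNReal.rpow_le_rpow h1 (by linarith : 0 ≤ r)
  rw [← ENNReal.rpow_mul, one_div_mul_cancel (by linarith), ENNReal.rpow_one,
    ENNReal.mul_rpow_of_nonneg _ _ (by linarith), ENNReal.ofReal_rpow_of_nonneg h0 (by linarith)]
    at h2
  calc _ ≤ ENNReal.ofReal (chaosConst d 2 r ^ r) * eLpNorm M 2 P ^ r / k.factorial := by gcongr
    _ = ENNReal.ofReal (chaosConst d 2 r ^ r / k.factorial) * eLpNorm M 2 P ^ r := by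
        rw [ENNReal.ofReal_div_of_pos (by positivity), ENNReal.ofReal_natCast, div_eq_mul_inv,
          div_eq_mul_inv]
        ring
    _ ≤ ENNReal.ofReal ((Real.exp 1 * 2 ^ (d + 5) / d) ^ k) * eLpNorm M 2 P ^ r := by gcongr
    _ = _ := by
        rw [hrdef, ENNReal.rpow_mul, ENNReal.rpow_natCast, ENNReal.ofReal_pow (by positivity),
          ← mul_pow, ENNReal.ofReal_div_of_pos hd0, ENNReal.ofReal_mul (by positivity),
          ENNReal.ofReal_natCast, ENNReal.ofReal_pow (by norm_num), div_eq_mul_inv, div_eq_mul_inv]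
        congr 1
        simp only [ENNReal.ofReal_ofNat, div_eq_mul_inv]
        ring

/-- Moment comparison implies exponential integrability of the power `2 / d`. -/
theorem MomentComparison.lintegral_exp_lt_top [IsProbabilityMeasure P]
    (h : MomentComparison P d M) (hd : 1 ≤ d) (hM : AEMeasurable M P)
    (hfin : ∀ᵐ ω ∂P, M ω < ∞) {ε : ℝ}
    (hε : ENNReal.ofReal ε < (d : ℝ≥0∞) / (ENNReal.ofReal (Real.exp 1) * 2 ^ (d + 5)
      * eLpNorm M 2 P ^ (2 / (d : ℝ)))) :
    ∫⁻ ω, EReal.exp ((ε : EReal) * ((M ω ^ (2 / (d : ℝ)) : ℝ≥0∞) : EReal)) ∂P < ∞ := by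
  have hd0 : (0 : ℝ) < d := by exact_mod_cast hd
  have hyfin : ∀ᵐ ω ∂P, M ω ^ (2 / (d : ℝ)) ≠ ∞ := by
    filter_upwards [hfin] with ω hω using (ENNReal.rpow_lt_top_of_nonneg (by positivity) hω.ne).ne
  -- For `ε ≤ 0` the integrand is at most `1`; the power series is used only for positive `ε`, where
  -- its terms are nonnegative and may be integrated one by one.
  rcases le_or_gt ε 0 with hε0 | hε0
  · refine lt_of_le_of_lt (lintegral_mono_ae (g := fun _ => 1) ?_) (by simp)
    filter_upwards [hyfin] with ω hω
    lift M ω ^ (2 / (d : ℝ)) to NNReal using hω with y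
    rw [EReal.coe_nnreal_eq_coe_real, ← EReal.coe_mul, EReal.exp_le_one_iff]
    exact_mod_cast mul_nonpos_of_nonpos_of_nonneg hε0 y.2
  set ρ : ℝ≥0∞ := ENNReal.ofReal ε *
    (ENNReal.ofReal (Real.exp 1) * 2 ^ (d + 5) * eLpNorm M 2 P ^ (2 / (d : ℝ)) / d)
  have hρ : ρ < 1 := by
    have := ENNReal.mul_lt_of_lt_div hε
    rw [show ρ = ENNReal.ofReal ε * (ENNReal.ofReal (Real.exp 1) * 2 ^ (d + 5) *
      eLpNorm M 2 P ^ (2 / (d : ℝ))) / d by simp only [ρ, div_eq_mul_inv, mul_assoc]]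
    refine ENNReal.div_lt_of_lt_mul ?_
    rwa [one_mul]
  let c : ℕ → ℝ≥0∞ := fun k =>
    ENNReal.ofReal ε ^ k / (k.factorial : ℝ≥0∞) * ∫⁻ ω, M ω ^ (2 / (d : ℝ) * k) ∂P
  -- Moment comparison from order `2` to order `2 k / d` requires `k > d` and then gives the
  -- geometric bound `ρ ^ k`. The finitely many terms with `k ≤ d` are finite because all moments
  -- are.
  have hc : ∀ k, c k ≤ (if k ∈ Finset.range (d + 1) then c k else 0) + ρ ^ k := fun k => by
    by_cases hk : k < d + 1
    · simp [hk]
    · rw [if_neg (by simpa using hk), zero_add]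
      have := h.lintegral_pow_le hd (by omega : d < k)
      calc c k = ENNReal.ofReal ε ^ k *
            ((∫⁻ ω, M ω ^ (2 / (d : ℝ) * k) ∂P) / (k.factorial : ℝ≥0∞)) := by
              simp only [c, div_eq_mul_inv]; ring
        _ ≤ ρ ^ k := (mul_le_mul_right this _).trans_eq (mul_pow _ _ _).symm
  have hsum : ∫⁻ ω, EReal.exp ((ε : EReal) * ((M ω ^ (2 / (d : ℝ)) : ℝ≥0∞) : EReal)) ∂P =
      ∑' k, c k := by
    rw [lintegral_congr_ae (g := fun ω => ∑' k : ℕ,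
      ENNReal.ofReal ε ^ k / (k.factorial : ℝ≥0∞) * (M ω ^ (2 / (d : ℝ))) ^ k)]
    · rw [lintegral_tsum fun k => ((hM.pow_const _).pow_const k).const_mul _]
      refine tsum_congr fun k => ?_
      rw [lintegral_const_mul'' _ ((hM.pow_const _).pow_const k)]
      simp only [c, ENNReal.rpow_mul, ENNReal.rpow_natCast]
    · filter_upwards [hyfin] with ω hω using ereal_exp_mul_eq_tsum hε0.le hω
  rw [hsum]
  refine lt_of_le_of_lt (ENNReal.tsum_le_tsum hc) ?_
  rw [ENNReal.tsum_add, ENNReal.tsum_geometric]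
  refine ENNReal.add_lt_top.2 ⟨?_, ?_⟩
  · rw [tsum_eq_sum (s := Finset.range (d + 1)) fun k hk => if_neg hk]
    refine ENNReal.sum_lt_top.2 fun k hk => ?_
    rw [if_pos hk]
    refine ENNReal.mul_lt_top ?_ (h.lintegral_rpow_ne_top (by positivity)).lt_top
    exact ENNReal.div_lt_top (ENNReal.pow_ne_top ENNReal.ofReal_ne_top)
      (by exact_mod_cast k.factorial_ne_zero)
  · exact ENNReal.inv_lt_top.2 (tsub_pos_of_lt hρ)

end Exponential

end GaussianChaos

theorem mainTheorem3
    {Ω : Type*} [MeasurableSpace Ω] (P : Measure Ω) [IsProbabilityMeasure P]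
    {F : Type*} [AddCommGroup F] [Module ℝ F] [TopologicalSpace F] [IsTopologicalAddGroup F]
    [ContinuousSMul ℝ F] [LocallyConvexSpace ℝ F] [T2Space F]
    [MeasurableSpace F] [BorelSpace F]
    (hF : MetrizableSpace F ∨ HereditarilyLindelofSpace F)
    (d : ℕ) (hd : 1 ≤ d)
    (𝒢 : Submodule ℝ (Ω → ℝ)) (h𝒢 : GaussianChaos.IsGaussianSpace P 𝒢)
    (X : Ω → F) (hX : Measurable X) (hsep : GaussianChaos.AESeparablyValued P X)
    (hweak : ∀ φ : F →L[ℝ] ℝ, (fun ω => φ (X ω)) ∈ GaussianChaos.gaussianChaos P 𝒢 d)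
    (N : F → ℝ≥0∞) (hN : GaussianChaos.IsPseudoSeminorm N) (hlsc : LowerSemicontinuous N)
    (hfin : ∀ᵐ ω ∂P, N (X ω) < ∞) :
    (∀ p r : ℝ, 1 < p → p < r →
      eLpNorm (fun ω => N (X ω)) (ENNReal.ofReal r) P
          ≤ ENNReal.ofReal ((2 : ℝ) ^ ((d : ℝ) ^ 2 / 2 + d)
              * ((r - 1) / (p - 1)) ^ ((d : ℝ) / 2))
            * eLpNorm (fun ω => N (X ω)) (ENNReal.ofReal p) P
        ∧ eLpNorm (fun ω => N (X ω)) (ENNReal.ofReal p) P < ∞) ∧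
    (∀ ε : ℝ,
      ENNReal.ofReal ε
          < (d : ℝ≥0∞) / (ENNReal.ofReal (Real.exp 1) * 2 ^ (d + 5)
              * eLpNorm (fun ω => N (X ω)) 2 P ^ (2 / (d : ℝ))) →
        ∫⁻ ω, EReal.exp ((ε : EReal) * ((N (X ω) ^ (2 / (d : ℝ)) : ℝ≥0∞) : EReal)) ∂P < ∞) := by
  have h := GaussianChaos.momentComparison_pseudoSeminorm hF h𝒢 hsep hweak hN hlsc hfin
  exact ⟨h, fun ε hε => h.lintegral_exp_lt_top hd (hlsc.measurable.comp hX).aemeasurable hfin hε⟩
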